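/- For complex numbers $\mu_0,\dots,\mu_m$ let $E_{(\mu_0,\dots,\mu_m)}$ be the space of all $f\in C^\infty(\mathbb R,\mathbb C)$ with $\left(\frac{d}{dx}-\mu_0\right)\cdots\left(\frac{d}{dx}-\mu_m\right)f=0$. Its Bernstein basis for $a<b$ is the (unique, if it exists) system $p_{(\mu_0,\dots,\mu_m),k}\in E_{(\mu_0,\dots,\mu_m)}$, $k=0,\dots,m$, such that $p_{(\mu_0,\dots,\mu_m),k}$ has a zero of order exactly $k$ at $a$, a zero of order exactly $m-k$ at $b$, and $k$-th derivative equal to $1$ at $a$. Let $a<b$, let $\lambda_0,\lambda_1,\lambda_2$ be distinct real numbers, and for each $n\ge 2$ let $\Lambda_n=(\lambda_0,\lambda_1,\lambda_2,\lambda_3,\dots,\lambda_n)$, where the complex numbers $\lambda_j=\lambda_j^{(n)}$, $3\le j\le n$, may vary with $n$. Suppose that for every $n\ge2$ the space $E_{\Lambda_n}$ is closed under complex conjugation, that there is $M>0$ with $|\operatorname{Im}\lambda_j|\le M$ for all $n\ge 2$ and $0\le j\le n$, and that $b-a<\pi/M_n$ for all $n\ge2$, where $M_n=\max_{0\le j\le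 n}|\operatorname{Im}\lambda_j|$ (no condition if $M_n=0$). (Then all Bernstein bases below exist, and all ratios of them below have positive limits.) For each $n\ge 2$ define $t_0=a$ and $t_1,\dots,t_n$ inductively by $$e^{(\lambda_0-\lambda_1)(t_k-t_{k-1})}=\lim_{x\uparrow b}\frac{p_{(\lambda_0,\lambda_2,\dots,\lambda_n),k-1}(x)}{p_{(\lambda_1,\lambda_2,\dots,\lambda_n),k-1}(x)},$$ put $$\alpha_k=e^{-\lambda_0(t_k-a)}(-1)^k\prod_{l=0}^{k-1}\lim_{x\uparrow b}\frac{\frac{d}{dx}p_{\Lambda_n,l}(x)}{p_{(\lambda_1,\dots,\lambda_n),l}(x)}\quad(0\le k\le n),$$ and let $B_{\Lambda_n}f=\sum_{k=0}^n\alpha_k f(t_k)\,p_{\Lambda_n,k}$ be the Bernstein operator on $C([a,b],\mathbb C)$. For $0\le k\le n-1$ put $$b(n,k)=\lim_{x\uparrow b}\frac{p_{(\lambda_0,\lambda_1,\lambda_3,\dots,\lambda_n),k}(x)}{p_{(\lambda_1,\lambda_2,\dots,\lambda_n),k}(x)}.$$ Assume that, as $n\to\infty$, $t_{k}-t_{k-1}\to0$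 uniformly in $k=1,\dots,n$, and $$\frac{\log b(n,k)}{t_k-t_{k+1}}\to\lambda_2-\lambda_0\quad\text{uniformly in }k=0,\dots,n-1.$$ Then for every $f\in C([a,b],\mathbb C)$ the functions $B_{\Lambda_n}f$ converge to $f$ uniformly on $[a,b]$. -/

import Mathlib

open Filter Topology
open scoped ContDiff

noncomputable section

/-- For `Λ = (λ₀, …, λₙ)`, the operator `(d/dx - λ₀) ⋯ (d/dx - λₙ)`. -/
def diffOp : List ℂ → (ℝ → ℂ) → ℝ → ℂ
  | [], f => f
  | μ :: Λ, f => fun x => deriv (diffOp Λ f) x - μ * diffOp Λ f x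

/-- The space `E_Λ` of exponential polynomials: smooth solutions of `L f = 0`. -/
def expPolySpace (Λ : List ℂ) : Set (ℝ → ℂ) :=
  {f | ContDiff ℝ ∞ f ∧ ∀ x, diffOp Λ f x = 0}

/-- The set of functions `E` is closed under complex conjugation. -/
def ClosedUnderConj (E : Set (ℝ → ℂ)) : Prop :=
  ∀ f ∈ E, (fun x => starRingEnd ℂ (f x)) ∈ E

/-- `f` has a zero of order (exactly) `k` at `c`. -/
def HasZeroOfOrder (f : ℝ → ℂ) (k : ℕ) (c : ℝ) : Prop :=
  (∀ i < k, iteratedDeriv i f c = 0) ∧ iteratedDeriv k f c ≠ 0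

/-- `p 0, …, p n` is the (normalized) Bernstein basis of `E_Λ` for `a, b`, where `Λ` has
`n + 1` entries; the values `p k` with `k > n` play no role. -/
def IsBernsteinBasis (Λ : List ℂ) (a b : ℝ) (p : ℕ → ℝ → ℂ) : Prop :=
  ∀ k < Λ.length, p k ∈ expPolySpace Λ ∧ HasZeroOfOrder (p k) k a ∧
    HasZeroOfOrder (p k) (Λ.length - 1 - k) b ∧ iteratedDeriv k (p k) a = 1

/-- The Bernstein basis `p_{Λ,k}`, `k = 0, …, n`, of `E_Λ` for `a, b`. It is unique when it
exists; if there is none the value is arbitrary. -/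
def bernsteinBasis (Λ : List ℂ) (a b : ℝ) : ℕ → ℝ → ℂ :=
  Classical.epsilon (IsBernsteinBasis Λ a b)

/-- The limit of `f x / g x` as `x` tends to `b` from inside the interval. -/
def boundaryLimit (f g : ℝ → ℂ) (b : ℝ) : ℂ :=
  limUnder (𝓝[<] b) (fun x => f x / g x)

/-- The nodes `t_k` of the Bernstein operator for `(λ₀, λ₁, R)` with `R = (λ₂, …, λₙ)`:
`t₀ = a` and `exp ((λ₀ - λ₁) (t_{k+1} - t_k)) = lim_{x → b} p_{(λ₀,R),k} x / p_{(λ₁,R),k} x`.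
(The limit is a positive real number for `k < n`.) -/
def bernsteinNode (a b lam0 lam1 : ℝ) (R : List ℂ) : ℕ → ℝ
  | 0 => a
  | k + 1 => bernsteinNode a b lam0 lam1 R k +
      Real.log (boundaryLimit (bernsteinBasis ((lam0 : ℂ) :: R) a b k)
        (bernsteinBasis ((lam1 : ℂ) :: R) a b k) b).re / (lam0 - lam1)

/-- The coefficients `α_k` of the Bernstein operator for `(λ₀, λ₁, R)`. -/
def bernsteinCoeff (a b lam0 lam1 : ℝ) (R : List ℂ) (k : ℕ) : ℂ :=
  (Real.exp (-lam0 * (bernsteinNode a b lam0 lam1 R k - a)) : ℂ) * (-1) ^ k *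
    ∏ l ∈ Finset.range k,
      boundaryLimit (deriv (bernsteinBasis ((lam0 : ℂ) :: (lam1 : ℂ) :: R) a b l))
        (bernsteinBasis ((lam1 : ℂ) :: R) a b l) b

/-- The Bernstein operator `B_Λ f = ∑_{k=0}^n α_k f(t_k) p_{Λ,k}` for `Λ = (λ₀, λ₁, R)`, a
vector with `n + 1` entries. Only the values of `f` at the nodes enter. -/
def bernsteinOp (a b lam0 lam1 : ℝ) (R : List ℂ) (f : ℝ → ℂ) (x : ℝ) : ℂ :=
  ∑ k ∈ Finset.range (R.length + 2),
    bernsteinCoeff a b lam0 lam1 R k * f (bernsteinNode a b lam0 lam1 R k) *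
      bernsteinBasis ((lam0 : ℂ) :: (lam1 : ℂ) :: R) a b k x

/-- `b(n,k) = lim_{x → b} p_{(λ₀,λ₁,T),k} x / p_{(λ₁,λ₂,T),k} x` with `T = (λ₃, …, λₙ)`.
(The limit is a positive real number for `k < n`.) -/
def ratioB (a b lam0 lam1 lam2 : ℝ) (T : List ℂ) (k : ℕ) : ℝ :=
  (boundaryLimit (bernsteinBasis ((lam0 : ℂ) :: (lam1 : ℂ) :: T) a b k)
    (bernsteinBasis ((lam1 : ℂ) :: (lam2 : ℂ) :: T) a b k) b).re

end

/-! The theorem is a Korovkin theorem for three exponentials. Write e_r(x) = exp(r(x - a)), p_k for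
the Bernstein basis of E_Λ, and D_Λ(k) > 0 for the absolute value of the first nonvanishing
derivative of p_{Λ,k} at b (`endCoeff`).

For a real entry r of Λ, with Λ' the remaining entries, d/dx - r maps p_{Λ,k} to p_{Λ',k-1} -
(D_Λ(k)/D_{Λ'}(k)) p_{Λ',k} (`firstOrder_bernsteinBasis`). A telescoping sum then gives e_r = ∑ c_k
p_k, where c_k is the product over l < k of D_Λ(l)/D_{Λ'}(l) (`exp_eq_sum_bernsteinBasis`). The
nodes are defined so that the coefficients of e_{λ₀} and e_{λ₁} have quotient exp((λ₀ - λ₁)(t_k -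
a)) (`expCoeff_eq_mul_exp`), hence B fixes both exponentials. They increase from a to b
(`exists_endCoeff_sub_eq`, `bernsteinNode_last`).

Division by e_{λ₀} turns B into averaging against nonnegative weights of sum 1 that reproduce
exp((λ₁ - λ₀)x) exactly. The coefficients of e_{λ₂} and e_{λ₀} have quotient ∏ 1/b(n,l). The
assumption on log b(n,k), summed over the steps of the node sequence, makes this uniformly close to
exp((λ₂ - λ₀)(t_k - a)), so the weights almost reproduce exp((λ₂ - λ₀)x)
(`abs_sum_bernsteinWeight_sub_one_le`). Then `exists_korovkin_bound` gives uniform convergence.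

Existence, realness and positivity of the Bernstein bases rest on a Chebyshev property
(`eqOn_zero_of_hasZerosGE`): a real-valued element of an N-dimensional admissible space with N zeros
in [a, b] vanishes. It is proved by Rolle's theorem, removing real eigenvalues singly and nonreal
ones in conjugate pairs. -/

/-! ### Algebra of the operators and of the spaces E_Λ. -/

/-- The operator `d/dx - μ`. -/
noncomputable def firstOrder (μ : ℂ) (f : ℝ → ℂ) : ℝ → ℂ := fun x => deriv f x - μ * f x

lemma diffOp_cons (μ : ℂ) (Λ : List ℂ) (f : ℝ → ℂ) :
    diffOp (μ :: Λ) f = firstOrder μ (diffOp Λ f) := rfl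

lemma contDiff_deriv_of_infty {f : ℝ → ℂ} (hf : ContDiff ℝ ∞ f) : ContDiff ℝ ∞ (deriv f) :=
  (contDiff_infty_iff_deriv.1 hf).2

lemma differentiable_of_infty {f : ℝ → ℂ} (hf : ContDiff ℝ ∞ f) : Differentiable ℝ f :=
  (contDiff_infty_iff_deriv.1 hf).1

lemma contDiff_firstOrder (μ : ℂ) {f : ℝ → ℂ} (hf : ContDiff ℝ ∞ f) :
    ContDiff ℝ ∞ (firstOrder μ f) :=
  (contDiff_deriv_of_infty hf).sub (contDiff_const.mul hf)

lemma contDiff_diffOp (Λ : List ℂ) {f : ℝ → ℂ} (hf : ContDiff ℝ ∞ f) :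
    ContDiff ℝ ∞ (diffOp Λ f) := by
  induction Λ with
  | nil => exact hf
  | cons μ Λ ih => exact contDiff_firstOrder μ ih

lemma deriv_firstOrder (μ : ℂ) {f : ℝ → ℂ} (hf : ContDiff ℝ ∞ f) (x : ℝ) :
    deriv (firstOrder μ f) x = deriv (deriv f) x - μ * deriv f x := by
  have h1 := (differentiable_of_infty (contDiff_deriv_of_infty hf) x).hasDerivAt
  have h2 := (differentiable_of_infty hf x).hasDerivAt
  exact (h1.sub (h2.const_mul μ)).deriv

lemma firstOrder_comm (μ ν : ℂ) {f : ℝ → ℂ} (hf : ContDiff ℝ ∞ f) :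
    firstOrder μ (firstOrder ν f) = firstOrder ν (firstOrder μ f) := by
  funext x
  change deriv (firstOrder ν f) x - μ * firstOrder ν f x =
    deriv (firstOrder μ f) x - ν * firstOrder μ f x
  rw [deriv_firstOrder ν hf, deriv_firstOrder μ hf]
  simp only [firstOrder]
  ring

lemma diffOp_firstOrder (μ : ℂ) (Λ : List ℂ) {f : ℝ → ℂ} (hf : ContDiff ℝ ∞ f) :
    diffOp Λ (firstOrder μ f) = firstOrder μ (diffOp Λ f) := by
  induction Λ with
  | nil => rfl
  | cons ν Λ ih => rw [diffOp_cons, diffOp_cons, ih, firstOrder_comm _ _ (contDiff_diffOp Λ hf)]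

lemma diffOp_perm {Λ Λ' : List ℂ} (h : Λ.Perm Λ') {f : ℝ → ℂ} (hf : ContDiff ℝ ∞ f) :
    diffOp Λ f = diffOp Λ' f := by
  induction h with
  | nil => rfl
  | cons μ _ ih => rw [diffOp_cons, diffOp_cons, ih]
  | swap μ ν Λ => exact firstOrder_comm _ _ (contDiff_diffOp Λ hf)
  | trans _ _ ih₁ ih₂ => exact ih₁.trans ih₂

lemma expPolySpace_perm {Λ Λ' : List ℂ} (h : Λ.Perm Λ') :
    expPolySpace Λ = expPolySpace Λ' := by
  ext f
  refine and_congr_right fun hf => ?_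
  rw [diffOp_perm h hf]

/-- The definition applies the head operator last; commutation allows it to be applied first, which
is what inductions on the list need. -/
lemma mem_expPolySpace_cons {μ : ℂ} {Λ : List ℂ} {f : ℝ → ℂ} :
    f ∈ expPolySpace (μ :: Λ) ↔ ContDiff ℝ ∞ f ∧ firstOrder μ f ∈ expPolySpace Λ := by
  constructor
  · rintro ⟨hf, h⟩
    refine ⟨hf, contDiff_firstOrder μ hf, fun x => ?_⟩
    rw [diffOp_firstOrder μ Λ hf]
    exact h x
  · rintro ⟨hf, -, h⟩
    refine ⟨hf, fun x => ?_⟩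
    rw [diffOp_cons, ← diffOp_firstOrder μ Λ hf]
    exact h x

lemma mem_expPolySpace_cons_of_mem (μ : ℂ) {Λ : List ℂ} {f : ℝ → ℂ} (hf : f ∈ expPolySpace Λ) :
    f ∈ expPolySpace (μ :: Λ) := by
  refine ⟨hf.1, fun x => ?_⟩
  have : diffOp Λ f = fun _ => 0 := funext hf.2
  simp [diffOp_cons, firstOrder, this]

lemma zero_mem_expPolySpace (Λ : List ℂ) : (fun _ => 0) ∈ expPolySpace Λ := by
  induction Λ with
  | nil => exact ⟨contDiff_const, fun _ => rfl⟩
  | cons μ Λ ih => exact mem_expPolySpace_cons_of_mem μ ih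

lemma firstOrder_add (μ : ℂ) {f g : ℝ → ℂ} (hf : ContDiff ℝ ∞ f) (hg : ContDiff ℝ ∞ g) :
    firstOrder μ (fun x => f x + g x) = fun x => firstOrder μ f x + firstOrder μ g x := by
  funext x
  have := ((differentiable_of_infty hf x).hasDerivAt.add
    (differentiable_of_infty hg x).hasDerivAt).deriv
  have h2 : deriv (fun x => f x + g x) x = deriv f x + deriv g x := this
  simp only [firstOrder, h2]
  ring

lemma firstOrder_const_mul (μ c : ℂ) {f : ℝ → ℂ} (hf : ContDiff ℝ ∞ f) :
    firstOrder μ (fun x => c * f x) = fun x => c * firstOrder μ f x := by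
  funext x
  have h2 : deriv (fun x => c * f x) x = c * deriv f x :=
    ((differentiable_of_infty hf x).hasDerivAt.const_mul c).deriv
  simp only [firstOrder, h2]
  ring

lemma diffOp_add (Λ : List ℂ) {f g : ℝ → ℂ} (hf : ContDiff ℝ ∞ f) (hg : ContDiff ℝ ∞ g) :
    diffOp Λ (fun x => f x + g x) = fun x => diffOp Λ f x + diffOp Λ g x := by
  induction Λ with
  | nil => rfl
  | cons μ Λ ih =>
    rw [diffOp_cons, ih, firstOrder_add μ (contDiff_diffOp Λ hf) (contDiff_diffOp Λ hg)]
    rfl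

lemma diffOp_const_mul (Λ : List ℂ) (c : ℂ) {f : ℝ → ℂ} (hf : ContDiff ℝ ∞ f) :
    diffOp Λ (fun x => c * f x) = fun x => c * diffOp Λ f x := by
  induction Λ with
  | nil => rfl
  | cons μ Λ ih =>
    rw [diffOp_cons, ih, firstOrder_const_mul μ c (contDiff_diffOp Λ hf)]
    rfl

lemma add_mem_expPolySpace {Λ : List ℂ} {f g : ℝ → ℂ} (hf : f ∈ expPolySpace Λ)
    (hg : g ∈ expPolySpace Λ) : (fun x => f x + g x) ∈ expPolySpace Λ :=
  ⟨hf.1.add hg.1, fun x => by rw [diffOp_add Λ hf.1 hg.1]; simp [hf.2 x, hg.2 x]⟩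

lemma const_mul_mem_expPolySpace {Λ : List ℂ} (c : ℂ) {f : ℝ → ℂ} (hf : f ∈ expPolySpace Λ) :
    (fun x => c * f x) ∈ expPolySpace Λ :=
  ⟨contDiff_const.mul hf.1, fun x => by rw [diffOp_const_mul Λ c hf.1]; simp [hf.2 x]⟩

lemma sub_mem_expPolySpace {Λ : List ℂ} {f g : ℝ → ℂ} (hf : f ∈ expPolySpace Λ)
    (hg : g ∈ expPolySpace Λ) : (fun x => f x - g x) ∈ expPolySpace Λ := by
  have := add_mem_expPolySpace hf (const_mul_mem_expPolySpace (-1) hg)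
  convert this using 2
  ring

lemma sum_mem_expPolySpace {Λ : List ℂ} {ι : Type*} (s : Finset ι) (f : ι → ℝ → ℂ)
    (hf : ∀ i ∈ s, f i ∈ expPolySpace Λ) : (fun x => ∑ i ∈ s, f i x) ∈ expPolySpace Λ := by
  classical
  induction s using Finset.induction_on with
  | empty => simpa using zero_mem_expPolySpace Λ
  | insert i s hi ih =>
    simp only [Finset.sum_insert hi]
    exact add_mem_expPolySpace (hf i (by simp)) (ih fun j hj => hf j (by simp [hj]))

lemma hasDerivAt_conj {f : ℝ → ℂ} {f' : ℂ} {x : ℝ} (hf : HasDerivAt f f' x) :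
    HasDerivAt (fun y => starRingEnd ℂ (f y)) (starRingEnd ℂ f') x := by
  simpa using hf.star

lemma contDiff_conj {f : ℝ → ℂ} (hf : ContDiff ℝ ∞ f) :
    ContDiff ℝ ∞ (fun y => starRingEnd ℂ (f y)) :=
  Complex.conjCLE.contDiff.comp hf

lemma deriv_conj {f : ℝ → ℂ} (hf : ContDiff ℝ ∞ f) :
    deriv (fun y => starRingEnd ℂ (f y)) = fun y => starRingEnd ℂ (deriv f y) :=
  funext fun x => (hasDerivAt_conj (differentiable_of_infty hf x).hasDerivAt).deriv

lemma diffOp_map_conj (Λ : List ℂ) {f : ℝ → ℂ} (hf : ContDiff ℝ ∞ f) :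
    diffOp (Λ.map (starRingEnd ℂ)) (fun y => starRingEnd ℂ (f y)) =
      fun y => starRingEnd ℂ (diffOp Λ f y) := by
  induction Λ with
  | nil => rfl
  | cons μ Λ ih =>
    rw [List.map_cons, diffOp_cons, ih]
    funext x
    simp only [firstOrder, deriv_conj (contDiff_diffOp Λ hf), diffOp_cons, map_sub, map_mul]

lemma conj_mem_expPolySpace {Λ : List ℂ} {f : ℝ → ℂ} (hf : f ∈ expPolySpace Λ) :
    (fun y => starRingEnd ℂ (f y)) ∈ expPolySpace (Λ.map (starRingEnd ℂ)) :=
  ⟨contDiff_conj hf.1, fun x => by rw [diffOp_map_conj Λ hf.1]; simp [hf.2 x]⟩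

/-! ### Exponentials, first order equations, and recovery of the eigenvalues from the space. -/

lemma hasDerivAt_cexp_mul (μ : ℂ) (c x : ℝ) :
    HasDerivAt (fun y : ℝ => Complex.exp (μ * (y - c))) (μ * Complex.exp (μ * (x - c))) x := by
  have h : HasDerivAt (fun y : ℝ => μ * ((y : ℂ) - c)) (μ * 1) x :=
    ((Complex.ofRealCLM.hasDerivAt (x := x)).sub_const (c : ℂ)).const_mul μ
  have := h.cexp
  convert this using 1
  ring

lemma contDiff_cexp_mul (μ : ℂ) (c : ℝ) :
    ContDiff ℝ ∞ (fun y : ℝ => Complex.exp (μ * (y - c))) :=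
  Complex.contDiff_exp.comp
    (contDiff_const.mul (Complex.ofRealCLM.contDiff.sub contDiff_const))

lemma firstOrder_cexp (μ ν : ℂ) (c : ℝ) :
    firstOrder ν (fun y : ℝ => Complex.exp (μ * (y - c))) =
      fun y : ℝ => (μ - ν) * Complex.exp (μ * (y - c)) := by
  funext x
  simp only [firstOrder, (hasDerivAt_cexp_mul μ c x).deriv]
  ring

lemma diffOp_cexp (Λ : List ℂ) (μ : ℂ) (c : ℝ) :
    diffOp Λ (fun y : ℝ => Complex.exp (μ * (y - c))) =
      fun y : ℝ => (Λ.map fun ν => μ - ν).prod * Complex.exp (μ * (y - c)) := by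
  induction Λ with
  | nil => simp [diffOp]
  | cons ν Λ ih =>
    rw [diffOp_cons, ih, firstOrder_const_mul _ _ (contDiff_cexp_mul μ c), firstOrder_cexp]
    funext x
    simp only [List.map_cons, List.prod_cons]
    ring

lemma cexp_mem_expPolySpace {Λ : List ℂ} {μ : ℂ} (h : μ ∈ Λ) (c : ℝ) :
    (fun y : ℝ => Complex.exp (μ * (y - c))) ∈ expPolySpace Λ := by
  refine ⟨contDiff_cexp_mul μ c, fun x => ?_⟩
  rw [diffOp_cexp]
  have : (Λ.map fun ν => μ - ν).prod = 0 :=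
    List.prod_eq_zero (List.mem_map.2 ⟨μ, h, sub_self μ⟩)
  simp [this]

lemma mem_of_cexp_mem_expPolySpace {Λ : List ℂ} {μ : ℂ} {c : ℝ}
    (h : (fun y : ℝ => Complex.exp (μ * (y - c))) ∈ expPolySpace Λ) : μ ∈ Λ := by
  have := h.2 c
  rw [diffOp_cexp] at this
  simp only [sub_self, mul_zero, Complex.exp_zero, mul_one] at this
  obtain ⟨ν, hν, h0⟩ := List.mem_map.1 (List.prod_eq_zero_iff.1 this)
  rwa [sub_eq_zero.1 h0]

/-- The inhomogeneous first order equation is solvable for every initial value. -/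
lemma exists_firstOrder_eq (μ : ℂ) {g : ℝ → ℂ} (hg : ContDiff ℝ ∞ g) (a : ℝ) (c : ℂ) :
    ∃ f, ContDiff ℝ ∞ f ∧ firstOrder μ f = g ∧ f a = c := by
  set h : ℝ → ℂ := fun y => Complex.exp (-μ * (y - a)) * g y with hh
  have hcont : ContDiff ℝ ∞ h := (contDiff_cexp_mul (-μ) a).mul hg
  set G : ℝ → ℂ := fun x => ∫ t in a..x, h t with hG
  have hGd : ∀ x, HasDerivAt G (h x) x := fun x =>
    intervalIntegral.integral_hasDerivAt_right (hcont.continuous.intervalIntegrable _ _)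
      (hcont.continuous.stronglyMeasurableAtFilter _ _) hcont.continuous.continuousAt
  have hGs : ContDiff ℝ ∞ G := by
    rw [contDiff_infty_iff_deriv]
    refine ⟨fun x => (hGd x).differentiableAt, ?_⟩
    rwa [show deriv G = h from funext fun x => (hGd x).deriv]
  refine ⟨fun x => Complex.exp (μ * (x - a)) * (c + G x),
    (contDiff_cexp_mul μ a).mul (contDiff_const.add hGs), ?_, by simp [hG]⟩
  funext x
  have := ((hasDerivAt_cexp_mul μ a x).mul ((hGd x).const_add c)).deriv
  have h2 : deriv (fun x : ℝ => Complex.exp (μ * (x - a)) * (c + G x)) x = _ := this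
  have h3 : Complex.exp (μ * (x - a)) * Complex.exp (-μ * (x - a)) = 1 := by
    rw [← Complex.exp_add]; simp
  simp only [firstOrder, h2, hh]
  linear_combination g x * h3

lemma eq_of_firstOrder_eq_zero {μ : ℂ} {f : ℝ → ℂ} (hf : ContDiff ℝ ∞ f)
    (h : ∀ x, firstOrder μ f x = 0) (a x : ℝ) : f x = f a * Complex.exp (μ * (x - a)) := by
  have hd : ∀ y, HasDerivAt (fun y : ℝ => f y * Complex.exp (-μ * (y - a))) 0 y := by
    intro y
    have := (differentiable_of_infty hf y).hasDerivAt.mul (hasDerivAt_cexp_mul (-μ) a y)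
    refine this.congr_deriv ?_
    have := h y
    simp only [firstOrder] at this
    linear_combination Complex.exp (-μ * (y - a)) * this
  have := is_const_of_deriv_eq_zero (fun y => (hd y).differentiableAt) (fun y => (hd y).deriv) x a
  simp only [sub_self, mul_zero, Complex.exp_zero, mul_one] at this
  rw [← this, mul_assoc, ← Complex.exp_add]
  simp

/-- An inclusion of spaces of exponential polynomials of the same order is an equality. -/
lemma perm_of_expPolySpace_subset {Λ Λ' : List ℂ} (hlen : Λ.length = Λ'.length)
    (h : expPolySpace Λ ⊆ expPolySpace Λ') : Λ.Perm Λ' := by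
  induction Λ generalizing Λ' with
  | nil => rw [List.length_eq_zero_iff.1 hlen.symm]
  | cons μ Λ ih =>
    have hμ : μ ∈ Λ' :=
      mem_of_cexp_mem_expPolySpace (h (cexp_mem_expPolySpace (List.mem_cons_self ..) 0))
    have hp := List.perm_cons_erase hμ
    refine (List.Perm.cons μ (ih ?_ ?_)).trans hp.symm
    · have := hp.length_eq
      simp only [List.length_cons] at this hlen
      omega
    -- Every g in E_Λ equals (d/dx - μ)f with f in E_{(μ,Λ)}, so the inclusion descends to the lists
    -- with μ removed.
    · intro g hg
      obtain ⟨f, hf, rfl, -⟩ := exists_firstOrder_eq μ hg.1 0 0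
      have : f ∈ expPolySpace Λ' := h (mem_expPolySpace_cons.2 ⟨hf, hg⟩)
      rw [expPolySpace_perm hp] at this
      exact (mem_expPolySpace_cons.1 this).2

/-- Turns the closure hypothesis on functions into the condition on the list of eigenvalues used in
`Admissible`. -/
lemma perm_map_conj_of_closedUnderConj {Λ : List ℂ} (h : ClosedUnderConj (expPolySpace Λ)) :
    (Λ.map (starRingEnd ℂ)).Perm Λ := by
  refine perm_of_expPolySpace_subset (by simp) fun f hf => ?_
  have h1 := conj_mem_expPolySpace hf
  have h2 : (Λ.map (starRingEnd ℂ)).map (starRingEnd ℂ) = Λ := by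
    simp [List.map_map, Function.comp_def]
  rw [h2] at h1
  simpa using h _ h1

/-! ### Orders of vanishing and the initial value problem. -/

lemma deriv_add_of_infty {f g : ℝ → ℂ} (hf : ContDiff ℝ ∞ f) (hg : ContDiff ℝ ∞ g) :
    deriv (fun x => f x + g x) = fun x => deriv f x + deriv g x :=
  funext fun x => ((differentiable_of_infty hf x).hasDerivAt.add
    (differentiable_of_infty hg x).hasDerivAt).deriv

lemma deriv_mul_of_infty {f g : ℝ → ℂ} (hf : ContDiff ℝ ∞ f) (hg : ContDiff ℝ ∞ g) :
    deriv (fun x => f x * g x) = fun x => deriv f x * g x + f x * deriv g x :=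
  funext fun x => ((differentiable_of_infty hf x).hasDerivAt.mul
    (differentiable_of_infty hg x).hasDerivAt).deriv

lemma deriv_const_mul_of_infty (c : ℂ) {f : ℝ → ℂ} (hf : ContDiff ℝ ∞ f) :
    deriv (fun x => c * f x) = fun x => c * deriv f x :=
  funext fun x => ((differentiable_of_infty hf x).hasDerivAt.const_mul c).deriv

lemma iteratedDeriv_add_of_infty (k : ℕ) {f g : ℝ → ℂ} (hf : ContDiff ℝ ∞ f)
    (hg : ContDiff ℝ ∞ g) (x : ℝ) :
    iteratedDeriv k (fun x => f x + g x) x = iteratedDeriv k f x + iteratedDeriv k g x := by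
  induction k generalizing f g with
  | zero => simp
  | succ k ih =>
    simp only [iteratedDeriv_succ']
    rw [deriv_add_of_infty hf hg, ih (contDiff_deriv_of_infty hf) (contDiff_deriv_of_infty hg)]

lemma iteratedDeriv_const_mul_of_infty (k : ℕ) (c : ℂ) {f : ℝ → ℂ} (hf : ContDiff ℝ ∞ f)
    (x : ℝ) : iteratedDeriv k (fun x => c * f x) x = c * iteratedDeriv k f x := by
  induction k generalizing f with
  | zero => simp
  | succ k ih =>
    simp only [iteratedDeriv_succ']
    rw [deriv_const_mul_of_infty c hf, ih (contDiff_deriv_of_infty hf)]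

lemma iteratedDeriv_sub_of_infty (k : ℕ) {f g : ℝ → ℂ} (hf : ContDiff ℝ ∞ f)
    (hg : ContDiff ℝ ∞ g) (x : ℝ) :
    iteratedDeriv k (fun x => f x - g x) x = iteratedDeriv k f x - iteratedDeriv k g x := by
  have h := iteratedDeriv_add_of_infty k hf (contDiff_const.mul hg : ContDiff ℝ ∞
    fun x => (-1 : ℂ) * g x) x
  rw [iteratedDeriv_const_mul_of_infty k _ hg] at h
  rw [show (fun x => f x - g x) = fun x => f x + -1 * g x from funext fun x => by ring, h]
  ring

lemma iteratedDeriv_firstOrder (k : ℕ) (μ : ℂ) {f : ℝ → ℂ} (hf : ContDiff ℝ ∞ f) (x : ℝ) :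
    iteratedDeriv k (firstOrder μ f) x =
      iteratedDeriv (k + 1) f x - μ * iteratedDeriv k f x := by
  rw [iteratedDeriv_succ', ← iteratedDeriv_const_mul_of_infty k μ hf,
    ← iteratedDeriv_sub_of_infty k (contDiff_deriv_of_infty hf) (contDiff_const.mul hf)]
  rfl

lemma iteratedDeriv_conj (k : ℕ) {f : ℝ → ℂ} (hf : ContDiff ℝ ∞ f) (x : ℝ) :
    iteratedDeriv k (fun y => starRingEnd ℂ (f y)) x = starRingEnd ℂ (iteratedDeriv k f x) := by
  induction k generalizing f with
  | zero => simp
  | succ k ih =>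
    simp only [iteratedDeriv_succ']
    rw [deriv_conj hf, ih (contDiff_deriv_of_infty hf)]

/-- `f` has a zero of order at least `k` at `c`. -/
def VanishesToOrder (f : ℝ → ℂ) (k : ℕ) (c : ℝ) : Prop :=
  ∀ i < k, iteratedDeriv i f c = 0

lemma vanishesToOrder_zero (f : ℝ → ℂ) (c : ℝ) : VanishesToOrder f 0 c :=
  fun i hi => absurd hi (Nat.not_lt_zero i)

lemma vanishesToOrder_succ' {f : ℝ → ℂ} {k : ℕ} {c : ℝ} :
    VanishesToOrder f (k + 1) c ↔ f c = 0 ∧ VanishesToOrder (deriv f) k c := by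
  constructor
  · intro h
    refine ⟨by simpa using h 0 (Nat.succ_pos k), fun i hi => ?_⟩
    rw [← iteratedDeriv_succ']
    exact h _ (by omega)
  · rintro ⟨h0, h⟩ i hi
    cases i with
    | zero => simpa using h0
    | succ i =>
      rw [iteratedDeriv_succ']
      exact h i (by omega)

lemma vanishesToOrder_succ {f : ℝ → ℂ} {k : ℕ} {c : ℝ} (h : VanishesToOrder f k c)
    (h' : iteratedDeriv k f c = 0) : VanishesToOrder f (k + 1) c := by
  intro i hi
  rcases Nat.lt_succ_iff_lt_or_eq.1 hi with hi | rfl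
  · exact h i hi
  · exact h'

lemma VanishesToOrder.mono {f : ℝ → ℂ} {k l : ℕ} {c : ℝ} (h : VanishesToOrder f k c)
    (hl : l ≤ k) : VanishesToOrder f l c :=
  fun i hi => h i (hi.trans_le hl)

lemma VanishesToOrder.add {f g : ℝ → ℂ} {k : ℕ} {c : ℝ} (hf : ContDiff ℝ ∞ f)
    (hg : ContDiff ℝ ∞ g) (h : VanishesToOrder f k c) (h' : VanishesToOrder g k c) :
    VanishesToOrder (fun x => f x + g x) k c := fun i hi => by
  rw [iteratedDeriv_add_of_infty i hf hg, h i hi, h' i hi, add_zero]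

lemma VanishesToOrder.sub {f g : ℝ → ℂ} {k : ℕ} {c : ℝ} (hf : ContDiff ℝ ∞ f)
    (hg : ContDiff ℝ ∞ g) (h : VanishesToOrder f k c) (h' : VanishesToOrder g k c) :
    VanishesToOrder (fun x => f x - g x) k c := fun i hi => by
  rw [iteratedDeriv_sub_of_infty i hf hg, h i hi, h' i hi, sub_zero]

lemma VanishesToOrder.const_mul {f : ℝ → ℂ} {k : ℕ} {c : ℝ} (r : ℂ) (hf : ContDiff ℝ ∞ f)
    (h : VanishesToOrder f k c) : VanishesToOrder (fun x => r * f x) k c := fun i hi => by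
  rw [iteratedDeriv_const_mul_of_infty i r hf, h i hi, mul_zero]

lemma VanishesToOrder.conj {f : ℝ → ℂ} {k : ℕ} {c : ℝ} (hf : ContDiff ℝ ∞ f)
    (h : VanishesToOrder f k c) : VanishesToOrder (fun x => starRingEnd ℂ (f x)) k c :=
  fun i hi => by rw [iteratedDeriv_conj i hf, h i hi, map_zero]

lemma VanishesToOrder.firstOrder {f : ℝ → ℂ} {k : ℕ} {c : ℝ} (μ : ℂ) (hf : ContDiff ℝ ∞ f)
    (h : VanishesToOrder f (k + 1) c) : VanishesToOrder (firstOrder μ f) k c := fun i hi => by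
  rw [iteratedDeriv_firstOrder i μ hf, h i (by omega), h (i + 1) (by omega), mul_zero, sub_zero]

lemma VanishesToOrder.mul_left {f g : ℝ → ℂ} {k : ℕ} {c : ℝ} (hg : ContDiff ℝ ∞ g)
    (hf : ContDiff ℝ ∞ f) (h : VanishesToOrder f k c) :
    VanishesToOrder (fun x => g x * f x) k c := by
  induction k generalizing f g with
  | zero => exact vanishesToOrder_zero _ _
  | succ k ih =>
    have h' := vanishesToOrder_succ'.1 h
    refine vanishesToOrder_succ'.2 ⟨by simp [h'.1], ?_⟩
    rw [deriv_mul_of_infty hg hf]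
    have hg' := contDiff_deriv_of_infty hg
    have hf' := contDiff_deriv_of_infty hf
    exact VanishesToOrder.add (hg'.mul hf) (hg.mul hf') (ih hg' hf (h.mono (Nat.le_succ k)))
      (ih hg hf' h'.2)

lemma VanishesToOrder.of_mul_left {f g : ℝ → ℂ} {k : ℕ} {c : ℝ} (hg : ContDiff ℝ ∞ g)
    (hf : ContDiff ℝ ∞ f) (hgc : g c ≠ 0) (h : VanishesToOrder (fun x => g x * f x) k c) :
    VanishesToOrder f k c := by
  induction k generalizing f with
  | zero => exact vanishesToOrder_zero _ _
  | succ k ih =>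
    have h' := vanishesToOrder_succ'.1 h
    rw [deriv_mul_of_infty hg hf] at h'
    have hg' := contDiff_deriv_of_infty hg
    have hf' := contDiff_deriv_of_infty hf
    refine vanishesToOrder_succ'.2 ⟨(mul_eq_zero.1 h'.1).resolve_left hgc, ih hf' ?_⟩
    have h1 := (ih hf (h.mono (Nat.le_succ k))).mul_left hg' hf
    have h2 := VanishesToOrder.sub ((hg'.mul hf).add (hg.mul hf')) (hg'.mul hf) h'.2 h1
    simpa using h2

lemma vanishesToOrder_of_eventually_eq_zero {f : ℝ → ℂ} {c : ℝ} (h : ∀ᶠ x in 𝓝 c, f x = 0)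
    (k : ℕ) : VanishesToOrder f k c := fun i _ => by
  have h' : f =ᶠ[𝓝 c] fun _ => 0 := h
  rw [h'.iteratedDeriv_eq i]
  simp

/-- Uniqueness for the initial value problem. -/
lemma eq_zero_of_vanishesToOrder {Λ : List ℂ} {f : ℝ → ℂ} {c : ℝ} (hf : f ∈ expPolySpace Λ)
    (h : VanishesToOrder f Λ.length c) (x : ℝ) : f x = 0 := by
  induction Λ generalizing f x with
  | nil => exact hf.2 x
  | cons μ Λ ih =>
    have h1 := ih (mem_expPolySpace_cons.1 hf).2 (VanishesToOrder.firstOrder μ hf.1 h)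
    rw [eq_of_firstOrder_eq_zero hf.1 h1 c x, (vanishesToOrder_succ'.1 h).1, zero_mul]

/-! ### Rolle-type zero counts for real-valued functions. -/

/-- `f` takes real values only. -/
def RealValued (f : ℝ → ℂ) : Prop := ∀ x, (f x).im = 0

lemma realValued_iff_conj {f : ℝ → ℂ} :
    RealValued f ↔ (fun x => starRingEnd ℂ (f x)) = f := by
  simp only [RealValued, funext_iff, Complex.conj_eq_iff_im]

lemma RealValued.deriv {f : ℝ → ℂ} (hf : ContDiff ℝ ∞ f) (h : RealValued f) :
    RealValued (deriv f) := by
  rw [realValued_iff_conj] at h ⊢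
  rw [← deriv_conj hf, h]

lemma RealValued.iteratedDeriv_im {f : ℝ → ℂ} (hf : ContDiff ℝ ∞ f) (h : RealValued f) (k : ℕ)
    (x : ℝ) : (iteratedDeriv k f x).im = 0 := by
  rw [← Complex.conj_eq_iff_im, ← iteratedDeriv_conj k hf, realValued_iff_conj.1 h]

lemma RealValued.mul {f g : ℝ → ℂ} (hf : RealValued f) (hg : RealValued g) :
    RealValued (fun x => f x * g x) := fun x => by simp [hf x, hg x]

lemma RealValued.sub {f g : ℝ → ℂ} (hf : RealValued f) (hg : RealValued g) :
    RealValued (fun x => f x - g x) := fun x => by simp [hf x, hg x]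

lemma RealValued.firstOrder {f : ℝ → ℂ} (hf : ContDiff ℝ ∞ f) (h : RealValued f) (r : ℝ) :
    RealValued (firstOrder r f) := fun x => by
  simp [_root_.firstOrder, h x, h.deriv hf x]

/-- There are at least `N` zeros of `f` in `[a, b]`; multiplicities count at the endpoints only. -/
def HasZerosGE (a b : ℝ) (f : ℝ → ℂ) (N : ℕ) : Prop :=
  ∃ (k l : ℕ) (S : Finset ℝ), VanishesToOrder f k a ∧ VanishesToOrder f l b ∧
    (∀ s ∈ S, s ∈ Set.Ioo a b ∧ f s = 0) ∧ N ≤ k + l + S.card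

/-- The determinant `f' c - f c'`, which is `c ^ 2 (f / c)'`. -/
noncomputable def wronskian (f c : ℝ → ℂ) : ℝ → ℂ := fun x => deriv f x * c x - f x * deriv c x

lemma contDiff_wronskian {f c : ℝ → ℂ} (hf : ContDiff ℝ ∞ f) (hc : ContDiff ℝ ∞ c) :
    ContDiff ℝ ∞ (wronskian f c) :=
  ((contDiff_deriv_of_infty hf).mul hc).sub (hf.mul (contDiff_deriv_of_infty hc))

lemma RealValued.wronskian {f c : ℝ → ℂ} (hf : ContDiff ℝ ∞ f) (hc : ContDiff ℝ ∞ c)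
    (hfr : RealValued f) (hcr : RealValued c) : RealValued (wronskian f c) :=
  ((hfr.deriv hf).mul hcr).sub (hfr.mul (hcr.deriv hc))

lemma hasDerivAt_re {f : ℝ → ℂ} (hf : ContDiff ℝ ∞ f) (x : ℝ) :
    HasDerivAt (fun y => (f y).re) (deriv f x).re x :=
  Complex.reCLM.hasFDerivAt.comp_hasDerivAt x (differentiable_of_infty hf x).hasDerivAt

lemma exists_wronskian_eq_zero {f c : ℝ → ℂ} (hf : ContDiff ℝ ∞ f) (hc : ContDiff ℝ ∞ c)
    (hfr : RealValued f) (hcr : RealValued c) {x y : ℝ} (hxy : x < y)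
    (hcz : ∀ z ∈ Set.Icc x y, c z ≠ 0) (hx : f x = 0) (hy : f y = 0) :
    ∃ z ∈ Set.Ioo x y, wronskian f c z = 0 := by
  have hcre : ∀ z ∈ Set.Icc x y, (c z).re ≠ 0 := fun z hz h =>
    hcz z hz (Complex.ext h (hcr z))
  have hd : ∀ z ∈ Set.Icc x y, HasDerivAt (fun z => (f z).re / (c z).re)
      (((deriv f z).re * (c z).re - (f z).re * (deriv c z).re) / (c z).re ^ 2) z :=
    fun z hz => (hasDerivAt_re hf z).div (hasDerivAt_re hc z) (hcre z hz)
  obtain ⟨z, hz, h⟩ := exists_hasDerivAt_eq_zero hxy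
    (fun z hz => (hd z hz).continuousAt.continuousWithinAt) (by simp [hx, hy])
    (fun z hz => hd z (Set.Ioo_subset_Icc_self hz))
  refine ⟨z, hz, ?_⟩
  have h' := (div_eq_zero_iff.1 h).resolve_right
    (pow_ne_zero 2 (hcre z (Set.Ioo_subset_Icc_self hz)))
  apply Complex.ext
  · simpa [wronskian, hfr z, hcr z] using h'
  · exact hfr.wronskian hf hc hcr z

/-- Induction on the largest element: the point found below the new maximum lies above the old one,
hence beyond all points found so far. -/
lemma exists_finset_between (A : Finset ℝ) (P : ℝ → Prop)
    (h : ∀ x ∈ A, ∀ y ∈ A, x < y → ∃ z ∈ Set.Ioo x y, P z) :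
    ∃ S : Finset ℝ, (∀ z ∈ S, P z ∧ ∃ x ∈ A, ∃ y ∈ A, x < z ∧ z < y) ∧ A.card ≤ S.card + 1 := by
  induction A using Finset.induction_on_max with
  | empty => exact ⟨∅, by simp, by simp⟩
  | insert m A hm ih =>
    obtain ⟨S, hS, hcard⟩ := ih fun x hx y hy => h x (by simp [hx]) y (by simp [hy])
    have hmA : m ∉ A := fun hA => lt_irrefl m (hm m hA)
    rcases A.eq_empty_or_nonempty with rfl | hne
    · exact ⟨∅, by simp, by simp⟩
    obtain ⟨z, hz, hPz⟩ := h (A.max' hne) (by simp [A.max'_mem hne]) m (by simp)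
      (hm _ (A.max'_mem hne))
    have hzS : z ∉ S := fun hzS => by
      obtain ⟨-, x, -, y, hy, -, hzy⟩ := hS z hzS
      exact absurd (A.le_max' y hy) (not_le.2 (hz.1.trans hzy))
    refine ⟨insert z S, ?_, ?_⟩
    · intro w hw
      rcases Finset.mem_insert.1 hw with rfl | hw
      · exact ⟨hPz, A.max' hne, by simp [A.max'_mem hne], m, by simp, hz.1, hz.2⟩
      · obtain ⟨hP, x, hx, y, hy, hxz⟩ := hS w hw
        exact ⟨hP, x, by simp [hx], y, by simp [hy], hxz⟩
    · rw [Finset.card_insert_of_notMem hmA, Finset.card_insert_of_notMem hzS]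
      omega

/-- Rolle's theorem for quotients, counting zeros in `[a, b]`. -/
lemma HasZerosGE.wronskian {a b : ℝ} (hab : a < b) {f c : ℝ → ℂ} (hf : ContDiff ℝ ∞ f)
    (hc : ContDiff ℝ ∞ c) (hfr : RealValued f) (hcr : RealValued c)
    (hcz : ∀ z ∈ Set.Icc a b, c z ≠ 0) {N : ℕ} (h : HasZerosGE a b f (N + 1)) :
    HasZerosGE a b (wronskian f c) N := by
  obtain ⟨k, l, S, hk, hl, hS, hN⟩ := h
  have hord : ∀ {j : ℕ} {p : ℝ}, VanishesToOrder f j p →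
      VanishesToOrder (_root_.wronskian f c) (j - 1) p := by
    intro j p hj
    cases j with
    | zero => exact vanishesToOrder_zero _ _
    | succ j =>
      have hf' := contDiff_deriv_of_infty hf
      have hc' := contDiff_deriv_of_infty hc
      have h1 := (vanishesToOrder_succ'.1 hj).2.mul_left hc hf'
      have h2 := (hj.mono (Nat.le_succ j)).mul_left hc' hf
      have h3 := VanishesToOrder.sub (hc.mul hf') (hc'.mul hf) h1 h2
      rw [show _root_.wronskian f c = fun x => c x * deriv f x - deriv c x * f x from
        funext fun x => by simp only [_root_.wronskian]; ring]
      exact h3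
  -- `A` is the set of distinct zeros, an endpoint included only if it is a zero. The Wronskian
  -- loses one order at each such endpoint, which is compensated by that endpoint counting as a
  -- point of `A`; Rolle between neighbours costs one, so the total loss is one.
  set A₁ : Finset ℝ := if 0 < k then insert a S else S with hA₁
  set A : Finset ℝ := if 0 < l then insert b A₁ else A₁ with hA
  have haS : a ∉ S := fun h => lt_irrefl a (hS a h).1.1
  have hA₁sub : ∀ x ∈ A₁, x ∈ Set.Ico a b ∧ f x = 0 := by
    intro x hx
    have hSx : x ∈ S → x ∈ Set.Ico a b ∧ f x = 0 := fun h =>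
      ⟨⟨(hS x h).1.1.le, (hS x h).1.2⟩, (hS x h).2⟩
    by_cases hk0 : 0 < k
    · rw [hA₁, if_pos hk0] at hx
      rcases Finset.mem_insert.1 hx with rfl | hx
      · exact ⟨⟨le_rfl, hab⟩, by simpa using hk 0 hk0⟩
      · exact hSx hx
    · rw [hA₁, if_neg hk0] at hx
      exact hSx hx
  have hbA₁ : b ∉ A₁ := fun h => lt_irrefl b (hA₁sub b h).1.2
  have hAsub : ∀ x ∈ A, x ∈ Set.Icc a b ∧ f x = 0 := by
    intro x hx
    have hSx : x ∈ A₁ → x ∈ Set.Icc a b ∧ f x = 0 := fun h =>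
      ⟨Set.Ico_subset_Icc_self (hA₁sub x h).1, (hA₁sub x h).2⟩
    by_cases hl0 : 0 < l
    · rw [hA, if_pos hl0] at hx
      rcases Finset.mem_insert.1 hx with rfl | hx
      · exact ⟨⟨hab.le, le_rfl⟩, by simpa using hl 0 hl0⟩
      · exact hSx hx
    · rw [hA, if_neg hl0] at hx
      exact hSx hx
  have hcard₁ : A₁.card = S.card + (if 0 < k then 1 else 0) := by
    rw [hA₁]; split_ifs
    · exact Finset.card_insert_of_notMem haS
    · rfl
  have hcard : A.card = A₁.card + (if 0 < l then 1 else 0) := by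
    rw [hA]; split_ifs
    · exact Finset.card_insert_of_notMem hbA₁
    · rfl
  obtain ⟨S', hS', hcard'⟩ := exists_finset_between A (fun z => _root_.wronskian f c z = 0)
    fun x hx y hy hxy => exists_wronskian_eq_zero hf hc hfr hcr hxy
      (fun z hz => hcz z ⟨(hAsub x hx).1.1.trans hz.1, hz.2.trans (hAsub y hy).1.2⟩)
      (hAsub x hx).2 (hAsub y hy).2
  refine ⟨k - 1, l - 1, S', hord hk, hord hl, fun z hz => ?_, ?_⟩
  · obtain ⟨h0, x, hx, y, hy, hxz, hzy⟩ := hS' z hz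
    exact ⟨⟨(hAsub x hx).1.1.trans_lt hxz, hzy.trans_le (hAsub y hy).1.2⟩, h0⟩
  · split_ifs at hcard₁ hcard <;> omega

lemma HasZerosGE.of_mul_left {a b : ℝ} {f c : ℝ → ℂ} (hab : a < b) (hf : ContDiff ℝ ∞ f)
    (hc : ContDiff ℝ ∞ c) (hcz : ∀ z ∈ Set.Icc a b, c z ≠ 0) {N : ℕ}
    (h : HasZerosGE a b (fun x => c x * f x) N) : HasZerosGE a b f N := by
  obtain ⟨k, l, S, hk, hl, hS, hN⟩ := h
  exact ⟨k, l, S, hk.of_mul_left hc hf (hcz a ⟨le_rfl, hab.le⟩),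
    hl.of_mul_left hc hf (hcz b ⟨hab.le, le_rfl⟩), fun s hs => ⟨(hS s hs).1,
      (mul_eq_zero.1 (hS s hs).2).resolve_left (hcz s (Set.Ioo_subset_Icc_self (hS s hs).1))⟩, hN⟩

lemma HasZerosGE.exists_eq_zero {a b : ℝ} {f : ℝ → ℂ} (hab : a < b) {N : ℕ}
    (h : HasZerosGE a b f (N + 1)) : ∃ x ∈ Set.Icc a b, f x = 0 := by
  obtain ⟨k, l, S, hk, hl, hS, hN⟩ := h
  rcases Nat.eq_zero_or_pos k with rfl | hk0
  · rcases Nat.eq_zero_or_pos l with rfl | hl0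
    · obtain ⟨s, hs⟩ := Finset.card_pos.1 (by omega : 0 < S.card)
      exact ⟨s, Set.Ioo_subset_Icc_self (hS s hs).1, (hS s hs).2⟩
    · exact ⟨b, ⟨hab.le, le_rfl⟩, by simpa using hl 0 hl0⟩
  · exact ⟨a, ⟨le_rfl, hab.le⟩, by simpa using hk 0 hk0⟩

/-- The converse direction of the Rolle step: f / c is constant on [a, b], and a single zero makes
the constant vanish. -/
lemma eq_zero_of_wronskian_eq_zero {a b : ℝ} (hab : a < b) {f c : ℝ → ℂ} (hf : ContDiff ℝ ∞ f)
    (hc : ContDiff ℝ ∞ c) (hcz : ∀ z ∈ Set.Icc a b, c z ≠ 0)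
    (hw : ∀ x ∈ Set.Ioo a b, wronskian f c x = 0) {p : ℝ} (hp : p ∈ Set.Icc a b) (hfp : f p = 0) :
    ∀ x ∈ Set.Icc a b, f x = 0 := by
  have hw' : Set.EqOn (wronskian f c) (fun _ => 0) (Set.Icc a b) :=
    Set.EqOn.of_subset_closure (s := Set.Ioo a b) hw
      (contDiff_wronskian hf hc).continuous.continuousOn continuousOn_const
      Set.Ioo_subset_Icc_self (by rw [closure_Ioo hab.ne])
  have hd : ∀ x ∈ Set.Icc a b, HasDerivAt (fun z => f z / c z) 0 x := by
    intro x hx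
    refine ((differentiable_of_infty hf x).hasDerivAt.div
      (differentiable_of_infty hc x).hasDerivAt (hcz x hx)).congr_deriv ?_
    have := hw' hx
    simp only [wronskian] at this
    rw [this, zero_div]
  have hconst := constant_of_has_deriv_right_zero
    (fun x hx => (hd x hx).continuousAt.continuousWithinAt)
    (fun x hx => (hd x (Set.Ico_subset_Icc_self hx)).hasDerivWithinAt)
  intro x hx
  have h1 := (hconst x hx).trans (hconst p hp).symm
  rw [hfp, zero_div] at h1
  exact (div_eq_zero_iff.1 h1).resolve_right (hcz x hx)

/-- Specializes Rolle for quotients to d/dx - μ. -/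
lemma wronskian_cexp (f : ℝ → ℂ) (μ : ℂ) (a : ℝ) :
    wronskian f (fun y : ℝ => Complex.exp (μ * (y - a))) =
      fun x : ℝ => Complex.exp (μ * (x - a)) * firstOrder μ f x := by
  funext x
  simp only [wronskian, firstOrder, (hasDerivAt_cexp_mul μ a x).deriv]
  ring

lemma realValued_cexp (r a : ℝ) : RealValued (fun y : ℝ => Complex.exp ((r : ℂ) * (y - a))) := by
  intro y
  beta_reduce
  rw [show (r : ℂ) * (y - a) = ((r * (y - a) : ℝ) : ℂ) by push_cast; ring, Complex.exp_ofReal_im]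

lemma HasZerosGE.firstOrder {a b : ℝ} (hab : a < b) {f : ℝ → ℂ} (hf : ContDiff ℝ ∞ f)
    (hfr : RealValued f) (r : ℝ) {N : ℕ} (h : HasZerosGE a b f (N + 1)) :
    HasZerosGE a b (firstOrder r f) N := by
  have h1 := h.wronskian hab hf (contDiff_cexp_mul r a) hfr (realValued_cexp r a)
    fun z _ => Complex.exp_ne_zero _
  rw [wronskian_cexp] at h1
  exact h1.of_mul_left hab (contDiff_firstOrder _ hf) (contDiff_cexp_mul r a)
    fun z _ => Complex.exp_ne_zero _

lemma eq_zero_of_firstOrder_eq_zero {a b : ℝ} (hab : a < b) {f : ℝ → ℂ} (hf : ContDiff ℝ ∞ f)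
    (μ : ℂ) (h0 : ∀ x ∈ Set.Ioo a b, firstOrder μ f x = 0) {N : ℕ}
    (h : HasZerosGE a b f (N + 1)) : ∀ x ∈ Set.Icc a b, f x = 0 := by
  obtain ⟨p, hp, hfp⟩ := h.exists_eq_zero hab
  refine eq_zero_of_wronskian_eq_zero hab hf (contDiff_cexp_mul μ a)
    (fun z _ => Complex.exp_ne_zero _) (fun x hx => ?_) hp hfp
  rw [wronskian_cexp]
  simp [h0 x hx]

/-! ### Elimination of conjugate pairs and the Chebyshev property. -/

/-- A solution of `((d/dx - r)² + s²) c = 0` without zeros near `m`. -/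
noncomputable def expCos (r s m : ℝ) (x : ℝ) : ℂ :=
  ((Real.exp (r * (x - m)) * Real.cos (s * (x - m)) : ℝ) : ℂ)

noncomputable def expSin (r s m : ℝ) (x : ℝ) : ℂ :=
  ((Real.exp (r * (x - m)) * Real.sin (s * (x - m)) : ℝ) : ℂ)

lemma hasDerivAt_real_mul_sub (r m x : ℝ) : HasDerivAt (fun y : ℝ => r * (y - m)) r x := by
  simpa using ((hasDerivAt_id x).sub_const m).const_mul r

lemma hasDerivAt_expCos (r s m x : ℝ) :
    HasDerivAt (expCos r s m) (r * expCos r s m x - s * expSin r s m x) x := by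
  have := (((hasDerivAt_real_mul_sub r m x).exp).mul
    ((hasDerivAt_real_mul_sub s m x).cos)).ofReal_comp
  refine this.congr_deriv ?_
  simp only [expCos, expSin]
  push_cast
  ring

lemma hasDerivAt_expSin (r s m x : ℝ) :
    HasDerivAt (expSin r s m) (r * expSin r s m x + s * expCos r s m x) x := by
  have := (((hasDerivAt_real_mul_sub r m x).exp).mul
    ((hasDerivAt_real_mul_sub s m x).sin)).ofReal_comp
  refine this.congr_deriv ?_
  simp only [expCos, expSin]
  push_cast
  ring

lemma contDiff_expCos (r s m : ℝ) : ContDiff ℝ ∞ (expCos r s m) := by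
  refine Complex.ofRealCLM.contDiff.comp (f := fun x : ℝ =>
    Real.exp (r * (x - m)) * Real.cos (s * (x - m))) ?_
  fun_prop

/-- Since c = `expCos` solves the second order equation of the pair, (d/dx - μ̄)(d/dx - μ)f equals
c⁻¹(d/dx - 2 Re μ) applied to the Wronskian of f and c, wherever c ≠ 0. A nonreal pair is thus
treated by two real Rolle steps. -/
lemma firstOrder_wronskian_expCos {f : ℝ → ℂ} (hf : ContDiff ℝ ∞ f) (μ : ℂ) (m : ℝ) :
    firstOrder ((2 * μ.re : ℝ) : ℂ) (wronskian f (expCos μ.re μ.im m)) = fun x =>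
      expCos μ.re μ.im m x * firstOrder (starRingEnd ℂ μ) (firstOrder μ f) x := by
  funext x
  have hc := hasDerivAt_expCos μ.re μ.im m
  have hs := hasDerivAt_expSin μ.re μ.im m
  have hc1 : deriv (expCos μ.re μ.im m) =
      fun x => μ.re * expCos μ.re μ.im m x - μ.im * expSin μ.re μ.im m x :=
    funext fun x => (hc x).deriv
  have hf1 := (differentiable_of_infty hf x).hasDerivAt
  have hf2 := (differentiable_of_infty (contDiff_deriv_of_infty hf) x).hasDerivAt
  have hw := (hf2.mul (hc x)).sub (hf1.mul (((hc x).const_mul (μ.re : ℂ)).sub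
    ((hs x).const_mul (μ.im : ℂ))))
  have hwe : deriv f * expCos μ.re μ.im m - f * ((fun y => ↑μ.re * expCos μ.re μ.im m y) -
      fun y => ↑μ.im * expSin μ.re μ.im m y) = wronskian f (expCos μ.re μ.im m) := by
    funext y
    simp only [wronskian, hc1, Pi.sub_apply, Pi.mul_apply]
  rw [hwe] at hw
  have hw' := hw.deriv
  have hL : firstOrder (starRingEnd ℂ μ) (firstOrder μ f) x =
      deriv (deriv f) x - (μ + starRingEnd ℂ μ) * deriv f x + μ * starRingEnd ℂ μ * f x := by
    change deriv (firstOrder μ f) x - _ * firstOrder μ f x = _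
    rw [deriv_firstOrder μ hf]
    simp only [firstOrder]
    ring
  rw [hL, Complex.add_conj, Complex.mul_conj, Complex.normSq_apply]
  simp only [firstOrder, hw', wronskian, hc1, Pi.sub_apply]
  push_cast
  ring

/-- The eigenvalues are stable under conjugation, with imaginary parts below `π / (b - a)`. -/
structure Admissible (a b : ℝ) (Λ : List ℂ) : Prop where
  perm_conj : (Λ.map (starRingEnd ℂ)).Perm Λ
  im_lt : ∀ μ ∈ Λ, |μ.im| * (b - a) < Real.pi

lemma Admissible.perm {a b : ℝ} {Λ Λ' : List ℂ} (h : Admissible a b Λ) (hp : Λ.Perm Λ') :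
    Admissible a b Λ' :=
  ⟨((hp.map _).symm.trans h.perm_conj).trans hp, fun μ hμ => h.im_lt μ (hp.mem_iff.2 hμ)⟩

lemma Admissible.of_cons {a b : ℝ} {Λ : List ℂ} {μ : ℂ} (h : Admissible a b (μ :: Λ))
    (hμ : μ.im = 0) : Admissible a b Λ := by
  refine ⟨?_, fun ν hν => h.im_lt ν (List.mem_cons_of_mem μ hν)⟩
  have := h.perm_conj
  rw [List.map_cons, Complex.conj_eq_iff_im.2 hμ] at this
  exact List.perm_cons μ |>.1 this

lemma Admissible.exists_perm {a b : ℝ} {Λ : List ℂ} {μ : ℂ} (h : Admissible a b (μ :: Λ))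
    (hμ : μ.im ≠ 0) : ∃ Λ', Λ.Perm (starRingEnd ℂ μ :: Λ') ∧ Admissible a b Λ' := by
  have hmem : starRingEnd ℂ μ ∈ Λ := by
    have h1 : starRingEnd ℂ μ ∈ μ :: Λ :=
      h.perm_conj.mem_iff.1 (by simp)
    refine (List.mem_cons.1 h1).resolve_left fun h2 => hμ (Complex.conj_eq_iff_im.1 h2)
  have hp := List.perm_cons_erase hmem
  refine ⟨_, hp, ?_, fun ν hν => h.im_lt ν (List.mem_cons_of_mem _ (List.mem_of_mem_erase hν))⟩
  have h' := (h.perm (List.Perm.cons μ hp)).perm_conj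
  simp only [List.map_cons, Complex.conj_conj] at h'
  exact List.perm_cons _ |>.1 (List.perm_cons _ |>.1 ((List.Perm.swap _ _ _).trans h'))

/-- Centred at the midpoint, the cosine has argument of absolute value at most |s|(b - a)/2 < π/2.
This is the role of the bound on the length of the interval. -/
lemma expCos_ne_zero {a b : ℝ} {r s : ℝ} (hs : |s| * (b - a) < Real.pi) :
    ∀ z ∈ Set.Icc a b, expCos r s ((a + b) / 2) z ≠ 0 := by
  intro z hz
  rw [expCos, Complex.ofReal_ne_zero]
  refine mul_ne_zero (Real.exp_ne_zero _) (ne_of_gt (Real.cos_pos_of_mem_Ioo ?_))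
  have h1 : |z - (a + b) / 2| ≤ (b - a) / 2 :=
    abs_le.2 ⟨by linarith [hz.1], by linarith [hz.2]⟩
  have h2 : |s * (z - (a + b) / 2)| < Real.pi / 2 := by
    rw [abs_mul]
    calc |s| * |z - (a + b) / 2| ≤ |s| * ((b - a) / 2) := by gcongr
      _ < Real.pi / 2 := by linarith
  exact ⟨by linarith [(abs_lt.1 h2).1], (abs_lt.1 h2).2⟩

/-- The real elements of the space of an admissible vector of length `N` form a Chebyshev
space: `N` zeros in `[a, b]` force the function to vanish. -/
lemma eqOn_zero_of_hasZerosGE {a b : ℝ} (hab : a < b) (n : ℕ) :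
    ∀ Λ : List ℂ, Λ.length ≤ n → Admissible a b Λ → ∀ f : ℝ → ℂ, ContDiff ℝ ∞ f → RealValued f →
      (∀ x ∈ Set.Ioo a b, diffOp Λ f x = 0) → HasZerosGE a b f Λ.length →
      ∀ x ∈ Set.Ioo a b, f x = 0 := by
  induction n with
  | zero =>
    intro Λ hΛ _ f _ _ h0 _
    rw [List.length_eq_zero_iff.1 (Nat.le_zero.1 hΛ)] at h0
    exact h0
  | succ n ih =>
    intro Λ hΛ hadm f hf hfr h0 hz
    cases Λ with
    | nil => exact h0
    | cons μ Λ =>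
      simp only [List.length_cons] at hΛ hz
      by_cases hμ : μ.im = 0
      · obtain ⟨r, rfl⟩ : ∃ r : ℝ, μ = r := ⟨μ.re, Complex.ext rfl (by simpa using hμ)⟩
        rw [diffOp_cons, ← diffOp_firstOrder _ _ hf] at h0
        have h1 := ih Λ (by omega) (hadm.of_cons hμ) (firstOrder r f)
          (contDiff_firstOrder _ hf) (hfr.firstOrder hf r) h0 (hz.firstOrder hab hf hfr r)
        exact fun x hx => eq_zero_of_firstOrder_eq_zero hab hf _ h1 hz x
          (Set.Ioo_subset_Icc_self hx)
      -- A nonreal eigenvalue is removed with its conjugate, so the list shrinks by two; hence the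
      -- induction over all lengths at most n.
      · obtain ⟨Λ', hp, hadm'⟩ := hadm.exists_perm hμ
        have hlen := hp.length_eq
        simp only [List.length_cons] at hlen
        rw [hlen] at hz
        set m := (a + b) / 2
        set c := expCos μ.re μ.im m with hcdef
        have hc : ContDiff ℝ ∞ c := contDiff_expCos _ _ _
        have hcr : RealValued c := fun x => Complex.ofReal_im _
        have hcz : ∀ z ∈ Set.Icc a b, c z ≠ 0 :=
          expCos_ne_zero (hadm.im_lt μ (List.mem_cons_self ..))
        have hw := contDiff_wronskian hf hc
        have hwr := hfr.wronskian hf hc hcr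
        have hwz := hz.wronskian hab hf hc hfr hcr hcz
        set g := firstOrder (starRingEnd ℂ μ) (firstOrder μ f) with hg
        have hgs : ContDiff ℝ ∞ g := contDiff_firstOrder _ (contDiff_firstOrder _ hf)
        have key := firstOrder_wronskian_expCos hf μ m
        have hgz : HasZerosGE a b g Λ'.length := by
          have := hwz.firstOrder hab hw hwr (2 * μ.re)
          rw [key] at this
          exact this.of_mul_left hab hgs hc hcz
        -- Neither factor preserves realness, but conjugation only exchanges the two commuting
        -- factors.
        have hgr : RealValued g := by
          rw [realValued_iff_conj]
          funext x
          have h1 := diffOp_map_conj [starRingEnd ℂ μ, μ] hf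
          rw [realValued_iff_conj.1 hfr] at h1
          have h2 := congrFun h1 x
          have h3 : diffOp [starRingEnd ℂ μ, μ] f = g := rfl
          rw [h3] at h2
          rw [← h2]
          simp only [List.map_cons, List.map_nil, Complex.conj_conj]
          change firstOrder μ (firstOrder (starRingEnd ℂ μ) f) x = g x
          rw [firstOrder_comm _ _ hf]
        have h0' : ∀ x ∈ Set.Ioo a b, diffOp Λ' g x = 0 := by
          intro x hx
          rw [hg, diffOp_firstOrder _ _ (contDiff_firstOrder _ hf), diffOp_firstOrder _ _ hf,
            firstOrder_comm _ _ (contDiff_diffOp _ hf), ← diffOp_cons, ← diffOp_cons,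
            ← diffOp_perm (List.Perm.cons μ hp) hf]
          exact h0 x hx
        have hg0 := ih Λ' (by omega) hadm' g hgs hgr h0' hgz
        have hw0 : ∀ x ∈ Set.Ioo a b, wronskian f c x = 0 := fun x hx =>
          eq_zero_of_firstOrder_eq_zero hab hw ((2 * μ.re : ℝ) : ℂ)
            (fun y hy => by rw [key]; beta_reduce; rw [← hg, hg0 y hy, mul_zero]) hwz x (Set.Ioo_subset_Icc_self hx)
        obtain ⟨p, hp, hfp⟩ := hz.exists_eq_zero hab
        exact fun x hx => eq_zero_of_wronskian_eq_zero hab hf hc hcz hw0 hp hfp x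
          (Set.Ioo_subset_Icc_self hx)

lemma eq_zero_of_eqOn_Ioo {a b : ℝ} (hab : a < b) {Λ : List ℂ} {f : ℝ → ℂ}
    (hf : f ∈ expPolySpace Λ) (h : ∀ x ∈ Set.Ioo a b, f x = 0) (x : ℝ) : f x = 0 := by
  have hm : (a + b) / 2 ∈ Set.Ioo a b := ⟨by linarith, by linarith⟩
  exact eq_zero_of_vanishesToOrder hf (vanishesToOrder_of_eventually_eq_zero
    (Filter.mem_of_superset (isOpen_Ioo.mem_nhds hm) h) _) x

lemma Admissible.conj_mem {a b : ℝ} {Λ : List ℂ} (h : Admissible a b Λ) {f : ℝ → ℂ}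
    (hf : f ∈ expPolySpace Λ) : (fun x => starRingEnd ℂ (f x)) ∈ expPolySpace Λ := by
  rw [← expPolySpace_perm h.perm_conj]
  exact conj_mem_expPolySpace hf

lemma eq_zero_of_realValued {a b : ℝ} (hab : a < b) {Λ : List ℂ} (hadm : Admissible a b Λ)
    {f : ℝ → ℂ} (hf : f ∈ expPolySpace Λ) (hfr : RealValued f)
    (hz : HasZerosGE a b f Λ.length) (x : ℝ) : f x = 0 :=
  eq_zero_of_eqOn_Ioo hab hf (eqOn_zero_of_hasZerosGE hab _ Λ le_rfl hadm f hf.1 hfr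
    (fun y _ => hf.2 y) hz) x

/-- A complex element of `E_Λ` with `N` zeros at the endpoints of `[a, b]` vanishes. -/
lemma eq_zero_of_vanishes_endpoints {a b : ℝ} (hab : a < b) {Λ : List ℂ}
    (hadm : Admissible a b Λ) {f : ℝ → ℂ} (hf : f ∈ expPolySpace Λ) {k l : ℕ}
    (hk : VanishesToOrder f k a) (hl : VanishesToOrder f l b) (hkl : Λ.length ≤ k + l) (x : ℝ) :
    f x = 0 := by
  have hg := hadm.conj_mem hf
  have real : ∀ g ∈ expPolySpace Λ, RealValued g → VanishesToOrder g k a →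
      VanishesToOrder g l b → g x = 0 := fun g hg hgr h1 h2 =>
    eq_zero_of_realValued hab hadm hg hgr ⟨k, l, ∅, h1, h2, by simp, by simpa using hkl⟩ x
  -- Up to constants these are the real and imaginary parts of f; both inherit the endpoint zeros.
  have h1 := real _ (add_mem_expPolySpace hf hg) (fun y => by simp)
    (hk.add hf.1 hg.1 (hk.conj hf.1)) (hl.add hf.1 hg.1 (hl.conj hf.1))
  have h2 := real _ (const_mul_mem_expPolySpace Complex.I (sub_mem_expPolySpace hf hg))
    (fun y => by simp)
    ((hk.sub hf.1 hg.1 (hk.conj hf.1)).const_mul _ (hf.1.sub hg.1))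
    ((hl.sub hf.1 hg.1 (hl.conj hf.1)).const_mul _ (hf.1.sub hg.1))
  have h3 := (mul_eq_zero.1 h2).resolve_left Complex.I_ne_zero
  linear_combination (h1 + h3) / 2

/-! ### Existence of the Bernstein basis. -/

lemma iteratedDeriv_sum_of_infty {ι : Type*} (s : Finset ι) (k : ℕ) (c : ι → ℂ) (f : ι → ℝ → ℂ)
    (hf : ∀ i ∈ s, ContDiff ℝ ∞ (f i)) (x : ℝ) :
    iteratedDeriv k (fun x => ∑ i ∈ s, c i * f i x) x = ∑ i ∈ s, c i * iteratedDeriv k (f i) x := by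
  classical
  induction s using Finset.induction_on with
  | empty => simp
  | insert i s hi ih =>
    simp only [Finset.sum_insert hi]
    have h1 := hf i (Finset.mem_insert_self i s)
    have h2 : ∀ j ∈ s, ContDiff ℝ ∞ (f j) := fun j hj => hf j (Finset.mem_insert_of_mem hj)
    rw [iteratedDeriv_add_of_infty k (contDiff_const.mul h1)
      (ContDiff.sum fun j hj => contDiff_const.mul (h2 j hj)), ih h2,
      iteratedDeriv_const_mul_of_infty k _ h1]

/-- Existence for the initial value problem. -/
lemma exists_mem_iteratedDeriv_eq (a : ℝ) (Λ : List ℂ) (c : ℕ → ℂ) :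
    ∃ f ∈ expPolySpace Λ, ∀ i < Λ.length, iteratedDeriv i f a = c i := by
  induction Λ generalizing c with
  | nil => exact ⟨_, zero_mem_expPolySpace [], fun i hi => absurd hi (Nat.not_lt_zero i)⟩
  | cons μ Λ ih =>
    obtain ⟨g, hg, hgc⟩ := ih fun i => c (i + 1) - μ * c i
    obtain ⟨f, hf, rfl, hfa⟩ := exists_firstOrder_eq μ hg.1 a (c 0)
    refine ⟨f, mem_expPolySpace_cons.2 ⟨hf, hg⟩, fun i => ?_⟩
    induction i with
    | zero => intro _; simpa using hfa
    | succ i ihi =>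
      intro hi
      rw [List.length_cons] at hi ihi
      have h1 := hgc i (by omega)
      rw [iteratedDeriv_firstOrder i μ hf, ihi (by omega)] at h1
      linear_combination h1

/-- Dimension count: the l + 1 solutions `e j`, whose only nonzero derivative of order below
`Λ.length` at a has order k + j, all vanish to order k at a, and vanishing to order l at b imposes l
linear conditions. The combination is nonzero because its derivatives at a return its coefficients.
-/
lemma exists_ne_zero_vanishes_endpoints (a b : ℝ) (Λ : List ℂ) (k l : ℕ)
    (hkl : k + l + 1 = Λ.length) :
    ∃ f ∈ expPolySpace Λ, VanishesToOrder f k a ∧ VanishesToOrder f l b ∧ ∃ x, f x ≠ 0 := by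
  choose e he hec using fun j : ℕ =>
    exists_mem_iteratedDeriv_eq a Λ fun i => if i = k + j then 1 else 0
  let φ : (Fin (l + 1) → ℂ) →ₗ[ℂ] (Fin l → ℂ) :=
    Matrix.mulVecLin (Matrix.of fun (i : Fin l) (j : Fin (l + 1)) => iteratedDeriv i (e j) b)
  have hker : LinearMap.ker φ ≠ ⊥ := LinearMap.ker_ne_bot_of_finrank_lt (by simp)
  obtain ⟨c, hc, hc0⟩ := (Submodule.ne_bot_iff _).1 hker
  obtain ⟨j, hj⟩ := Function.ne_iff.1 hc0
  set f : ℝ → ℂ := fun x => ∑ j : Fin (l + 1), c j * e j x with hf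
  have hd : ∀ i x, iteratedDeriv i f x = ∑ j : Fin (l + 1), c j * iteratedDeriv i (e j) x :=
    fun i x => iteratedDeriv_sum_of_infty _ i c (fun j => e j) (fun j _ => (he j).1) x
  have hda : ∀ i < Λ.length, iteratedDeriv i f a =
      ∑ j : Fin (l + 1), c j * if i = k + j then 1 else 0 := fun i hi => by
    rw [hd]
    exact Finset.sum_congr rfl fun j _ => by rw [hec j i hi]
  refine ⟨f, sum_mem_expPolySpace _ _ fun j _ => const_mul_mem_expPolySpace _ (he j), ?_, ?_, ?_⟩
  · intro i hi
    rw [hda i (by omega)]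
    exact Finset.sum_eq_zero fun j _ => by rw [if_neg (by omega), mul_zero]
  · intro i hi
    have h1 := congrFun (LinearMap.mem_ker.1 hc) ⟨i, hi⟩
    simp only [φ, Matrix.mulVecLin_apply, Matrix.mulVec, dotProduct, Matrix.of_apply,
      Pi.zero_apply] at h1
    rw [hd, ← h1]
    exact Finset.sum_congr rfl fun j _ => mul_comm _ _
  · by_contra! h0
    have h1 := hda (k + j) (by omega)
    rw [show f = fun _ => 0 from funext h0, Finset.sum_eq_single j] at h1
    · exact hj (by simpa using h1.symm)
    · intro i _ hij
      rw [if_neg (by simpa using fun h => hij (Fin.ext h.symm)), mul_zero]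
    · simp

/-- The orders are exact because one further zero at either end would reach the dimension and force
the function to vanish. -/
lemma exists_isBernsteinBasis {a b : ℝ} (hab : a < b) {Λ : List ℂ} (hadm : Admissible a b Λ) :
    ∃ p, IsBernsteinBasis Λ a b p := by
  have h : ∀ k, ∃ p : ℝ → ℂ, k < Λ.length → p ∈ expPolySpace Λ ∧ HasZeroOfOrder p k a ∧
      HasZeroOfOrder p (Λ.length - 1 - k) b ∧ iteratedDeriv k p a = 1 := by
    intro k
    by_cases hk : k < Λ.length
    swap
    · exact ⟨0, fun h => absurd h hk⟩
    obtain ⟨f, hf, hfa, hfb, x, hx⟩ :=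
      exists_ne_zero_vanishes_endpoints a b Λ k (Λ.length - 1 - k) (by omega)
    have hka : iteratedDeriv k f a ≠ 0 := fun h0 => hx <|
      eq_zero_of_vanishes_endpoints hab hadm hf (vanishesToOrder_succ hfa h0) hfb (by omega) x
    have hkb : iteratedDeriv (Λ.length - 1 - k) f b ≠ 0 := fun h0 => hx <|
      eq_zero_of_vanishes_endpoints hab hadm hf hfa (vanishesToOrder_succ hfb h0) (by omega) x
    refine ⟨fun x => (iteratedDeriv k f a)⁻¹ * f x, fun _ => ⟨const_mul_mem_expPolySpace _ hf,
      ⟨hfa.const_mul _ hf.1, ?_⟩, ⟨hfb.const_mul _ hf.1, ?_⟩, ?_⟩⟩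
    all_goals rw [iteratedDeriv_const_mul_of_infty _ _ hf.1]
    · exact mul_ne_zero (inv_ne_zero hka) hka
    · exact mul_ne_zero (inv_ne_zero hka) hkb
    · exact inv_mul_cancel₀ hka
  choose p hp using h
  exact ⟨p, hp⟩

lemma isBernsteinBasis_perm {Λ Λ' : List ℂ} (h : Λ.Perm Λ') (a b : ℝ) :
    IsBernsteinBasis Λ a b = IsBernsteinBasis Λ' a b := by
  funext p
  simp only [IsBernsteinBasis, h.length_eq, expPolySpace_perm h]

lemma bernsteinBasis_perm {Λ Λ' : List ℂ} (h : Λ.Perm Λ') (a b : ℝ) :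
    bernsteinBasis Λ a b = bernsteinBasis Λ' a b := by
  simp only [bernsteinBasis, isBernsteinBasis_perm h]

/-! ### Boundary limits as quotients of derivatives, and positivity of the basis. -/

lemma tendsto_div_pow_of_vanishesToOrder {f : ℝ → ℂ} (hf : ContDiff ℝ ∞ f) {l : ℕ} {c : ℝ}
    (h : VanishesToOrder f l c) :
    Tendsto (fun x : ℝ => f x / ((x - c : ℝ) : ℂ) ^ l) (𝓝[≠] c)
      (𝓝 (iteratedDeriv l f c / (l.factorial : ℂ))) := by
  have h1 := taylor_tendsto (f := f) (n := l) convex_univ (Set.mem_univ c)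
    (hf.of_le (by exact_mod_cast le_top)).contDiffOn
  rw [nhdsWithin_univ] at h1
  have h2 := (h1.mono_left (nhdsWithin_le_nhds (s := {c}ᶜ))).add_const
    (iteratedDeriv l f c / (l.factorial : ℂ))
  rw [zero_add] at h2
  refine h2.congr' ?_
  filter_upwards [self_mem_nhdsWithin] with x hx
  have hxc : ((x - c : ℝ) : ℂ) ^ l ≠ 0 :=
    pow_ne_zero _ (Complex.ofReal_ne_zero.2 (sub_ne_zero.2 hx))
  have ht : taylorWithinEval f l Set.univ c x =
      ((x - c : ℝ) : ℂ) ^ l * (iteratedDeriv l f c / (l.factorial : ℂ)) := by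
    rw [taylor_within_apply, Finset.sum_range_succ, Finset.sum_eq_zero, zero_add,
      iteratedDerivWithin_univ, Complex.real_smul]
    · push_cast
      ring
    · intro i hi
      rw [iteratedDerivWithin_univ, h i (Finset.mem_range.1 hi), smul_zero]
  rw [ht, Complex.real_smul]
  push_cast at hxc ⊢
  field_simp
  ring

lemma boundaryLimit_eq {f g : ℝ → ℂ} (hf : ContDiff ℝ ∞ f) (hg : ContDiff ℝ ∞ g) {l : ℕ} {b : ℝ}
    (hfl : VanishesToOrder f l b) (hgl : VanishesToOrder g l b) (hg0 : iteratedDeriv l g b ≠ 0) :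
    boundaryLimit f g b = iteratedDeriv l f b / iteratedDeriv l g b := by
  have hfac : (l.factorial : ℂ) ≠ 0 := by exact_mod_cast l.factorial_ne_zero
  have h1 := (tendsto_div_pow_of_vanishesToOrder hf hfl).div
    (tendsto_div_pow_of_vanishesToOrder hg hgl) (div_ne_zero hg0 hfac)
  rw [div_div_div_cancel_right₀ hfac] at h1
  refine Tendsto.limUnder_eq ((h1.mono_left (nhdsWithin_mono b ?_)).congr' ?_)
  · exact fun x (hx : x < b) => hx.ne
  · filter_upwards [self_mem_nhdsWithin] with x (hx : x < b)
    have hxc : ((x - b : ℝ) : ℂ) ^ l ≠ 0 :=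
      pow_ne_zero _ (Complex.ofReal_ne_zero.2 (sub_ne_zero.2 hx.ne))
    simp only [Pi.div_apply]
    rw [div_div_div_cancel_right₀ hxc]

/-- The absolute value of the first nonvanishing derivative of `p_{Λ,k}` at `b`. -/
noncomputable def endCoeff (a b : ℝ) (Λ : List ℂ) (k : ℕ) : ℝ :=
  (-1) ^ (Λ.length - 1 - k) * (iteratedDeriv (Λ.length - 1 - k) (bernsteinBasis Λ a b k) b).re

section Basis

variable {a b : ℝ} (hab : a < b) {Λ : List ℂ} (hadm : Admissible a b Λ) {k : ℕ}
  (hk : k < Λ.length)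

include hab hadm hk

lemma bernsteinBasis_spec : bernsteinBasis Λ a b k ∈ expPolySpace Λ ∧
    HasZeroOfOrder (bernsteinBasis Λ a b k) k a ∧
    HasZeroOfOrder (bernsteinBasis Λ a b k) (Λ.length - 1 - k) b ∧
    iteratedDeriv k (bernsteinBasis Λ a b k) a = 1 :=
  Classical.epsilon_spec (exists_isBernsteinBasis hab hadm) k hk

lemma bernsteinBasis_mem : bernsteinBasis Λ a b k ∈ expPolySpace Λ :=
  (bernsteinBasis_spec hab hadm hk).1

lemma contDiff_bernsteinBasis : ContDiff ℝ ∞ (bernsteinBasis Λ a b k) :=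
  (bernsteinBasis_mem hab hadm hk).1

lemma bernsteinBasis_left : VanishesToOrder (bernsteinBasis Λ a b k) k a :=
  (bernsteinBasis_spec hab hadm hk).2.1.1

lemma bernsteinBasis_right : VanishesToOrder (bernsteinBasis Λ a b k) (Λ.length - 1 - k) b :=
  (bernsteinBasis_spec hab hadm hk).2.2.1.1

lemma iteratedDeriv_bernsteinBasis_left : iteratedDeriv k (bernsteinBasis Λ a b k) a = 1 :=
  (bernsteinBasis_spec hab hadm hk).2.2.2

lemma realValued_bernsteinBasis : RealValued (bernsteinBasis Λ a b k) := by
  rw [realValued_iff_conj]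
  have hm := bernsteinBasis_mem hab hadm hk
  have hc := hadm.conj_mem hm
  have ha := bernsteinBasis_left hab hadm hk
  have hb := bernsteinBasis_right hab hadm hk
  funext x
  refine sub_eq_zero.1 (eq_zero_of_vanishes_endpoints hab hadm (sub_mem_expPolySpace hc hm)
    (k := k + 1) (l := Λ.length - 1 - k) ?_ ?_ (by omega) x)
  · refine vanishesToOrder_succ ((ha.conj hm.1).sub hc.1 hm.1 ha) ?_
    rw [iteratedDeriv_sub_of_infty k hc.1 hm.1, iteratedDeriv_conj k hm.1,
      iteratedDeriv_bernsteinBasis_left hab hadm hk, map_one, sub_self]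
  · exact (hb.conj hm.1).sub hc.1 hm.1 hb

lemma bernsteinBasis_ne_zero {x : ℝ} (hx : x ∈ Set.Ioo a b) : bernsteinBasis Λ a b k x ≠ 0 := by
  intro h0
  -- An interior zero added to the k + (N - 1 - k) endpoint zeros gives N, the length of Λ.
  have h1 := eq_zero_of_realValued hab hadm (bernsteinBasis_mem hab hadm hk)
    (realValued_bernsteinBasis hab hadm hk) ⟨k, Λ.length - 1 - k, {x},
      bernsteinBasis_left hab hadm hk, bernsteinBasis_right hab hadm hk,
      fun s hs => by rw [Finset.mem_singleton.1 hs]; exact ⟨hx, h0⟩, by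
        rw [Finset.card_singleton]; omega⟩
  have h2 := iteratedDeriv_bernsteinBasis_left hab hadm hk
  rw [show bernsteinBasis Λ a b k = fun _ => 0 from funext h1] at h2
  simp at h2

/-- The normalization at a makes the function positive just to the right of a; a sign change would
produce an interior zero. -/
lemma bernsteinBasis_re_pos {x : ℝ} (hx : x ∈ Set.Ioo a b) :
    0 < (bernsteinBasis Λ a b k x).re := by
  have hs := contDiff_bernsteinBasis hab hadm hk
  have hr := realValued_bernsteinBasis hab hadm hk
  have h1 := tendsto_div_pow_of_vanishesToOrder hs (bernsteinBasis_left hab hadm hk)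
  rw [iteratedDeriv_bernsteinBasis_left hab hadm hk] at h1
  have h2 := (Complex.continuous_re.tendsto _).comp
    (h1.mono_left (nhdsWithin_mono a (fun x (hx : a < x) => hx.ne')) : Tendsto _ (𝓝[>] a) _)
  have hlim : 0 < (1 / (k.factorial : ℂ)).re := by
    rw [show (1 / (k.factorial : ℂ)) = ((1 / (k.factorial : ℝ) : ℝ) : ℂ) by push_cast; rfl,
      Complex.ofReal_re]
    positivity
  by_contra! hneg
  obtain ⟨y, hy, hyx⟩ := ((h2.eventually (lt_mem_nhds hlim)).and
    (Filter.eventually_mem_set.2 (Ioo_mem_nhdsGT hx.1))).exists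
  have hypos : 0 < (bernsteinBasis Λ a b k y).re := by
    simp only [Function.comp_apply, ← Complex.ofReal_pow, Complex.div_ofReal_re] at hy
    exact (div_pos_iff_of_pos_right (pow_pos (sub_pos.2 hyx.1) k)).1 hy
  obtain ⟨z, hz, hz0⟩ := intermediate_value_Icc' hyx.2.le
    (Complex.continuous_re.comp hs.continuous).continuousOn ⟨hneg, hypos.le⟩
  exact bernsteinBasis_ne_zero hab hadm hk ⟨hyx.1.trans_le hz.1, hz.2.trans_lt hx.2⟩
    (Complex.ext hz0 (hr z))

lemma bernsteinBasis_re_nonneg {x : ℝ} (hx : x ∈ Set.Icc a b) :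
    0 ≤ (bernsteinBasis Λ a b k x).re := by
  have hcont := Complex.continuous_re.comp (contDiff_bernsteinBasis hab hadm hk).continuous
  have hx' : x ∈ closure (Set.Ioo a b) := by rwa [closure_Ioo hab.ne]
  exact closure_minimal (fun y hy => (bernsteinBasis_re_pos hab hadm hk hy).le)
    (isClosed_Ici.preimage hcont) hx'

lemma iteratedDeriv_bernsteinBasis_right :
    iteratedDeriv (Λ.length - 1 - k) (bernsteinBasis Λ a b k) b =
      (((-1) ^ (Λ.length - 1 - k) * endCoeff a b Λ k : ℝ) : ℂ) := by
  rw [endCoeff, ← mul_assoc, ← mul_pow]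
  apply Complex.ext
  · simp
  · rw [Complex.ofReal_im]
    exact (realValued_bernsteinBasis hab hadm hk).iteratedDeriv_im
      (contDiff_bernsteinBasis hab hadm hk) _ _

lemma endCoeff_pos : 0 < endCoeff a b Λ k := by
  set l := Λ.length - 1 - k with hl
  have hs := contDiff_bernsteinBasis hab hadm hk
  have hne : endCoeff a b Λ k ≠ 0 := by
    intro h0
    have h1 := iteratedDeriv_bernsteinBasis_right hab hadm hk
    rw [h0, mul_zero] at h1
    exact (bernsteinBasis_spec hab hadm hk).2.2.1.2 (by simpa using h1)
  refine lt_of_le_of_ne ?_ hne.symm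
  have h1 := tendsto_div_pow_of_vanishesToOrder hs (bernsteinBasis_right hab hadm hk)
  rw [iteratedDeriv_bernsteinBasis_right hab hadm hk, ← hl] at h1
  have h2 := ((Complex.continuous_re.tendsto _).comp
    (h1.mono_left (nhdsWithin_mono b (fun x (hx : x < b) => hx.ne)) :
      Tendsto _ (𝓝[<] b) _)).const_mul ((-1 : ℝ) ^ l)
  rw [show (((-1) ^ l * endCoeff a b Λ k : ℝ) : ℂ) / (l.factorial : ℂ) =
    (((-1) ^ l * endCoeff a b Λ k / l.factorial : ℝ) : ℂ) by push_cast; rfl,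
    Complex.ofReal_re, mul_div_assoc, ← mul_assoc, ← mul_pow] at h2
  simp only [mul_neg, mul_one, neg_neg, one_pow, one_mul] at h2
  have h3 : 0 ≤ endCoeff a b Λ k / l.factorial := by
    refine ge_of_tendsto h2 ?_
    filter_upwards [Ioo_mem_nhdsLT hab] with x hx
    simp only [Function.comp_apply, ← Complex.ofReal_pow, Complex.div_ofReal_re]
    rw [show x - b = -1 * (b - x) by ring, mul_pow, ← div_div, mul_div_assoc', mul_div_cancel₀]
    · exact div_nonneg (bernsteinBasis_re_pos hab hadm hk hx).le
        (pow_nonneg (sub_nonneg.2 hx.2.le) _)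
    · exact pow_ne_zero _ (by norm_num)
  have h4 : (0 : ℝ) < l.factorial := by exact_mod_cast l.factorial_pos
  rw [le_div_iff₀ h4, zero_mul] at h3
  exact h3

end Basis

lemma endCoeff_perm {Λ Λ' : List ℂ} (h : Λ.Perm Λ') (a b : ℝ) (k : ℕ) :
    endCoeff a b Λ k = endCoeff a b Λ' k := by
  simp only [endCoeff, h.length_eq, bernsteinBasis_perm h]

lemma boundaryLimit_bernsteinBasis {a b : ℝ} (hab : a < b) {Λ Λ' : List ℂ}
    (hadm : Admissible a b Λ) (hadm' : Admissible a b Λ') (hlen : Λ.length = Λ'.length) {k : ℕ}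
    (hk : k < Λ.length) :
    boundaryLimit (bernsteinBasis Λ a b k) (bernsteinBasis Λ' a b k) b =
      ((endCoeff a b Λ k / endCoeff a b Λ' k : ℝ) : ℂ) := by
  have hk' : k < Λ'.length := hlen ▸ hk
  have h1 := bernsteinBasis_right hab hadm' hk'
  have h2 := iteratedDeriv_bernsteinBasis_right hab hadm' hk'
  have h3 := (bernsteinBasis_spec hab hadm' hk').2.2.1.2
  rw [← hlen] at h1 h2 h3
  rw [boundaryLimit_eq (contDiff_bernsteinBasis hab hadm hk)
    (contDiff_bernsteinBasis hab hadm' hk') (bernsteinBasis_right hab hadm hk) h1 h3, h2,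
    iteratedDeriv_bernsteinBasis_right hab hadm hk, ← Complex.ofReal_div,
    mul_div_mul_left _ _ (pow_ne_zero _ (by norm_num))]

/-- Differentiation lowers the order at b by one, to that of the denominator. The parities then
differ by one; the resulting minus sign is what (-1)^k in `bernsteinCoeff` cancels. -/
lemma boundaryLimit_deriv_bernsteinBasis {a b : ℝ} (hab : a < b) {Λ : List ℂ} {μ : ℂ}
    (hadm : Admissible a b (μ :: Λ)) (hadm' : Admissible a b Λ) {k : ℕ} (hk : k < Λ.length) :
    boundaryLimit (deriv (bernsteinBasis (μ :: Λ) a b k)) (bernsteinBasis Λ a b k) b =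
      ((-(endCoeff a b (μ :: Λ) k / endCoeff a b Λ k) : ℝ) : ℂ) := by
  have hk' : k < (μ :: Λ).length := by rw [List.length_cons]; omega
  have hl : (μ :: Λ).length - 1 - k = Λ.length - 1 - k + 1 := by rw [List.length_cons]; omega
  have h1 := bernsteinBasis_right hab hadm hk'
  have h2 := iteratedDeriv_bernsteinBasis_right hab hadm hk'
  have h3 := (bernsteinBasis_spec hab hadm' hk).2.2.1.2
  rw [hl] at h1 h2
  rw [iteratedDeriv_succ'] at h2
  rw [boundaryLimit_eq (contDiff_deriv_of_infty (contDiff_bernsteinBasis hab hadm hk'))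
    (contDiff_bernsteinBasis hab hadm' hk) (vanishesToOrder_succ'.1 h1).2
    (bernsteinBasis_right hab hadm' hk) h3, h2,
    iteratedDeriv_bernsteinBasis_right hab hadm' hk, ← Complex.ofReal_div, pow_succ, mul_assoc,
    mul_div_mul_left _ _ (pow_ne_zero _ (by norm_num))]
  congr 1
  ring

/-! ### Action of d/dx - r on the basis and expansion of exponentials. -/

/-- The basis function `p_{Λ,k-1}`, or `0` if `k = 0`. -/
noncomputable def prevBasis (a b : ℝ) (Λ : List ℂ) (k : ℕ) : ℝ → ℂ :=
  if k = 0 then fun _ => 0 else bernsteinBasis Λ a b (k - 1)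

section Step

variable {a b : ℝ} (hab : a < b) {Λ : List ℂ} {r : ℝ} (hadm : Admissible a b ((r : ℂ) :: Λ))

include hab hadm

lemma prevBasis_mem {k : ℕ} (hk : k ≤ Λ.length) : prevBasis a b Λ k ∈ expPolySpace Λ := by
  rw [prevBasis]
  split_ifs with h
  · exact zero_mem_expPolySpace Λ
  · exact bernsteinBasis_mem hab (hadm.of_cons (Complex.ofReal_im r)) (by omega)

lemma prevBasis_right {k : ℕ} (hk : k ≤ Λ.length) :
    VanishesToOrder (prevBasis a b Λ k) (Λ.length - k) b := by
  rw [prevBasis]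
  split_ifs with h
  · intro i _
    simp
  · have := bernsteinBasis_right hab (hadm.of_cons (Complex.ofReal_im r))
      (by omega : k - 1 < Λ.length)
    exact this.mono (by omega)

lemma firstOrder_sub_prevBasis_mem {k : ℕ} (hk : k ≤ Λ.length) :
    (fun x => firstOrder r (bernsteinBasis ((r : ℂ) :: Λ) a b k) x - prevBasis a b Λ k x) ∈
      expPolySpace Λ :=
  sub_mem_expPolySpace (mem_expPolySpace_cons.1 (bernsteinBasis_mem hab hadm
    (by rw [List.length_cons]; omega))).2 (prevBasis_mem hab hadm hk)

/-- Both terms have (k-1)-th derivative 1 at a, so subtraction gains one order. -/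
lemma firstOrder_sub_prevBasis_left {k : ℕ} (hk : k ≤ Λ.length) :
    VanishesToOrder (fun x => firstOrder r (bernsteinBasis ((r : ℂ) :: Λ) a b k) x -
      prevBasis a b Λ k x) k a := by
  have hadm' := hadm.of_cons (Complex.ofReal_im r)
  have hk' : k < ((r : ℂ) :: Λ).length := by rw [List.length_cons]; omega
  have hP := contDiff_bernsteinBasis hab hadm hk'
  have hPa := bernsteinBasis_left hab hadm hk'
  have hP1 := iteratedDeriv_bernsteinBasis_left hab hadm hk'
  cases k with
  | zero => exact vanishesToOrder_zero _ _
  | succ j =>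
    have hj : j < Λ.length := by omega
    have hQ := contDiff_bernsteinBasis hab hadm' hj
    have hprev : prevBasis a b Λ (j + 1) = bernsteinBasis Λ a b j := by simp [prevBasis]
    rw [hprev]
    refine vanishesToOrder_succ (VanishesToOrder.sub (contDiff_firstOrder _ hP) hQ
      (hPa.firstOrder _ hP) (bernsteinBasis_left hab hadm' hj)) ?_
    rw [iteratedDeriv_sub_of_infty j (contDiff_firstOrder _ hP) hQ,
      iteratedDeriv_firstOrder j _ hP, hP1, hPa j (Nat.lt_succ_self j),
      iteratedDeriv_bernsteinBasis_left hab hadm' hj]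
    ring

lemma firstOrder_bernsteinBasis_last (x : ℝ) :
    firstOrder r (bernsteinBasis ((r : ℂ) :: Λ) a b Λ.length) x = prevBasis a b Λ Λ.length x :=
  sub_eq_zero.1 (eq_zero_of_vanishesToOrder (firstOrder_sub_prevBasis_mem hab hadm le_rfl)
    (firstOrder_sub_prevBasis_left hab hadm le_rfl) x)

/-- The action of `d/dx - r` on the Bernstein basis. -/
lemma firstOrder_bernsteinBasis {k : ℕ} (hk : k < Λ.length) (x : ℝ) :
    firstOrder r (bernsteinBasis ((r : ℂ) :: Λ) a b k) x = prevBasis a b Λ k x -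
      ((endCoeff a b ((r : ℂ) :: Λ) k / endCoeff a b Λ k : ℝ) : ℂ) * bernsteinBasis Λ a b k x := by
  have hadm' := hadm.of_cons (Complex.ofReal_im r)
  have hk' : k < ((r : ℂ) :: Λ).length := by rw [List.length_cons]; omega
  have hl : ((r : ℂ) :: Λ).length - 1 - k = Λ.length - 1 - k + 1 := by
    rw [List.length_cons]; omega
  have hP := contDiff_bernsteinBasis hab hadm hk'
  have hQ := contDiff_bernsteinBasis hab hadm' hk
  have hprev := (prevBasis_mem hab hadm hk.le).1
  have hm := firstOrder_sub_prevBasis_mem hab hadm hk.le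
  -- `d` is the factor that cancels the leading derivative at b. Adding d p_{Λ,k} gives k zeros at a
  -- and `Λ.length` - k at b, enough to vanish.
  set d : ℂ := ((endCoeff a b ((r : ℂ) :: Λ) k / endCoeff a b Λ k : ℝ) : ℂ) with hd
  have hdQ := const_mul_mem_expPolySpace d (bernsteinBasis_mem hab hadm' hk)
  have hPb := bernsteinBasis_right hab hadm hk'
  have hPb1 := iteratedDeriv_bernsteinBasis_right hab hadm hk'
  rw [hl] at hPb hPb1
  have hprevb := prevBasis_right hab hadm hk.le
  have hfo := contDiff_firstOrder (r : ℂ) hP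
  have key := eq_zero_of_vanishes_endpoints hab hadm' (add_mem_expPolySpace hm hdQ) (k := k)
    (l := Λ.length - 1 - k + 1)
    ((firstOrder_sub_prevBasis_left hab hadm hk.le).add hm.1 hdQ.1
      ((bernsteinBasis_left hab hadm' hk).const_mul d hQ))
    (vanishesToOrder_succ (VanishesToOrder.add hm.1 hdQ.1
      (VanishesToOrder.sub hfo hprev (hPb.firstOrder _ hP) (hprevb.mono (by omega)))
      ((bernsteinBasis_right hab hadm' hk).const_mul d hQ)) ?_) (by omega) x
  · linear_combination key
  · rw [iteratedDeriv_add_of_infty _ hm.1 hdQ.1, iteratedDeriv_sub_of_infty _ hfo hprev,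
      iteratedDeriv_firstOrder _ _ hP, iteratedDeriv_const_mul_of_infty _ _ hQ, hPb1,
      hPb _ (Nat.lt_succ_self _), hprevb _ (by omega),
      iteratedDeriv_bernsteinBasis_right hab hadm' hk, hd]
    have hpos := (endCoeff_pos hab hadm' hk).ne'
    have : (endCoeff a b Λ k : ℂ) ≠ 0 := by exact_mod_cast hpos
    push_cast
    field_simp
    ring

end Step

/-- The coefficients of `exp (μ (x - a))` in the Bernstein basis of `E_{(μ, Λ)}`. -/
noncomputable def expCoeff (a b : ℝ) (μ : ℂ) (Λ : List ℂ) (k : ℕ) : ℝ :=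
  ∏ l ∈ Finset.range k, endCoeff a b (μ :: Λ) l / endCoeff a b Λ l

lemma expCoeff_pos {a b : ℝ} (hab : a < b) {Λ : List ℂ} {r : ℝ}
    (hadm : Admissible a b ((r : ℂ) :: Λ)) {k : ℕ} (hk : k ≤ Λ.length) :
    0 < expCoeff a b r Λ k := by
  refine Finset.prod_pos fun l hl => ?_
  have hl' := Finset.mem_range.1 hl
  exact div_pos (endCoeff_pos hab hadm (by rw [List.length_cons]; omega))
    (endCoeff_pos hab (hadm.of_cons (Complex.ofReal_im r)) (by omega))

lemma firstOrder_sum {ι : Type*} (μ : ℂ) (s : Finset ι) (c : ι → ℂ) (f : ι → ℝ → ℂ)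
    (hf : ∀ i ∈ s, ContDiff ℝ ∞ (f i)) (x : ℝ) :
    firstOrder μ (fun x => ∑ i ∈ s, c i * f i x) x = ∑ i ∈ s, c i * firstOrder μ (f i) x := by
  have h := iteratedDeriv_sum_of_infty s 1 c f hf x
  simp only [iteratedDeriv_one] at h
  simp only [firstOrder, h, Finset.mul_sum, mul_sub, Finset.sum_sub_distrib]
  congr 1
  exact Finset.sum_congr rfl fun i _ => by ring

/-- The coefficients are built so that d/dx - r makes the sum telescope to zero; the value at a is 1
because only p_0 is nonzero there. -/
lemma exp_eq_sum_bernsteinBasis {a b : ℝ} (hab : a < b) {Λ : List ℂ} {r : ℝ}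
    (hadm : Admissible a b ((r : ℂ) :: Λ)) (x : ℝ) :
    Complex.exp (r * (x - a)) = ∑ k ∈ Finset.range (Λ.length + 1),
      (expCoeff a b r Λ k : ℂ) * bernsteinBasis ((r : ℂ) :: Λ) a b k x := by
  have hP : ∀ k ∈ Finset.range (Λ.length + 1),
      ContDiff ℝ ∞ (bernsteinBasis ((r : ℂ) :: Λ) a b k) := fun k hk =>
    contDiff_bernsteinBasis hab hadm (by simpa using hk)
  set F : ℝ → ℂ := fun x => ∑ k ∈ Finset.range (Λ.length + 1),
      (expCoeff a b r Λ k : ℂ) * bernsteinBasis ((r : ℂ) :: Λ) a b k x with hF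
  have hFs : ContDiff ℝ ∞ F := ContDiff.sum fun k hk => contDiff_const.mul (hP k hk)
  have hF0 : ∀ y, firstOrder r F y = 0 := by
    intro y
    rw [hF, firstOrder_sum _ _ _ _ hP, Finset.sum_range_succ,
      firstOrder_bernsteinBasis_last hab hadm]
    have h1 : ∀ k ∈ Finset.range Λ.length, (expCoeff a b r Λ k : ℂ) *
        firstOrder r (bernsteinBasis ((r : ℂ) :: Λ) a b k) y =
        expCoeff a b r Λ k * prevBasis a b Λ k y -
          expCoeff a b r Λ (k + 1) * prevBasis a b Λ (k + 1) y := by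
      intro k hk
      rw [firstOrder_bernsteinBasis hab hadm (Finset.mem_range.1 hk), expCoeff, expCoeff,
        Finset.prod_range_succ]
      simp only [prevBasis, Nat.add_one_ne_zero, if_false, Nat.add_sub_cancel]
      push_cast
      ring
    rw [Finset.sum_congr rfl h1, Finset.sum_range_sub']
    simp [prevBasis]
  have hFa : F a = 1 := by
    rw [hF]
    beta_reduce
    rw [Finset.sum_range_succ', Finset.sum_eq_zero, zero_add]
    · have := iteratedDeriv_bernsteinBasis_left hab hadm (k := 0) (by simp)
      rw [iteratedDeriv_zero] at this
      simp [expCoeff, this]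
    · intro k hk
      have := bernsteinBasis_left hab hadm (k := k + 1) (by simpa using hk) 0 (Nat.succ_pos k)
      rw [iteratedDeriv_zero] at this
      rw [this, mul_zero]
  have := eq_of_firstOrder_eq_zero hFs hF0 a x
  rw [hFa, one_mul] at this
  exact this.symm

/-! ### Nodes and coefficients of the operator. -/

section Nodes

variable {a b : ℝ} (hab : a < b) {R : List ℂ} {lam0 lam1 : ℝ}
  (hadm : Admissible a b ((lam0 : ℂ) :: (lam1 : ℂ) :: R))

include hadm

lemma admissible_tail : Admissible a b ((lam1 : ℂ) :: R) := hadm.of_cons (Complex.ofReal_im _)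

lemma admissible_swap : Admissible a b ((lam1 : ℂ) :: (lam0 : ℂ) :: R) :=
  hadm.perm (List.Perm.swap _ _ _)

include hab

/-- Gives the monotonicity of the nodes. The difference of p_{(λ₀,R),k} and p_{(λ₁,R),k} has one
more zero at a, so it is a multiple c of p_{(λ₀,λ₁,R),k+1}. Leading derivatives at b express the
difference of the end coefficients through c, and (k+1)-th derivatives at a express c through that
difference. -/
lemma exists_endCoeff_sub_eq {k : ℕ} (hk : k ≤ R.length) :
    ∃ c > 0, endCoeff a b ((lam0 : ℂ) :: R) k - endCoeff a b ((lam1 : ℂ) :: R) k =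
      (lam0 - lam1) * c := by
  have hadm1 := admissible_tail hadm
  have hadm0 := admissible_tail (admissible_swap hadm)
  have hadmR := hadm1.of_cons (Complex.ofReal_im _)
  have hk0 : k < ((lam0 : ℂ) :: R).length := by rw [List.length_cons]; omega
  have hk1 : k < ((lam1 : ℂ) :: R).length := by rw [List.length_cons]; omega
  have hkP : k + 1 < ((lam0 : ℂ) :: (lam1 : ℂ) :: R).length := by
    simp only [List.length_cons]; omega
  have hu := contDiff_bernsteinBasis hab hadm0 hk0
  have hv := contDiff_bernsteinBasis hab hadm1 hk1
  have hP := contDiff_bernsteinBasis hab hadm hkP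
  have hu1 := iteratedDeriv_bernsteinBasis_left hab hadm0 hk0
  have hv1 := iteratedDeriv_bernsteinBasis_left hab hadm1 hk1
  have hum : bernsteinBasis ((lam0 : ℂ) :: R) a b k ∈
      expPolySpace ((lam0 : ℂ) :: (lam1 : ℂ) :: R) := by
    rw [expPolySpace_perm (List.Perm.swap _ _ _)]
    exact mem_expPolySpace_cons_of_mem _ (bernsteinBasis_mem hab hadm0 hk0)
  have hvm : bernsteinBasis ((lam1 : ℂ) :: R) a b k ∈
      expPolySpace ((lam0 : ℂ) :: (lam1 : ℂ) :: R) :=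
    mem_expPolySpace_cons_of_mem _ (bernsteinBasis_mem hab hadm1 hk1)
  have hPpos := endCoeff_pos hab hadm hkP
  have hub := bernsteinBasis_right hab hadm0 hk0
  have hvb := bernsteinBasis_right hab hadm1 hk1
  have hPb := bernsteinBasis_right hab hadm hkP
  have hub1 := iteratedDeriv_bernsteinBasis_right hab hadm0 hk0
  have hvb1 := iteratedDeriv_bernsteinBasis_right hab hadm1 hk1
  have hPb1 := iteratedDeriv_bernsteinBasis_right hab hadm hkP
  have e0 : ((lam0 : ℂ) :: R).length - 1 - k = R.length - k := by rw [List.length_cons]; omega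
  have e1 : ((lam1 : ℂ) :: R).length - 1 - k = R.length - k := by rw [List.length_cons]; omega
  have eP : ((lam0 : ℂ) :: (lam1 : ℂ) :: R).length - 1 - (k + 1) = R.length - k := by
    simp only [List.length_cons]; omega
  rw [e0] at hub hub1
  rw [e1] at hvb hvb1
  rw [eP] at hPb hPb1
  set u := bernsteinBasis ((lam0 : ℂ) :: R) a b k
  set v := bernsteinBasis ((lam1 : ℂ) :: R) a b k
  set P := bernsteinBasis ((lam0 : ℂ) :: (lam1 : ℂ) :: R) a b (k + 1)
  set c : ℂ := iteratedDeriv (k + 1) u a - iteratedDeriv (k + 1) v a with hc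
  have huva : VanishesToOrder (fun x => u x - v x) (k + 1) a := by
    refine vanishesToOrder_succ (VanishesToOrder.sub hu hv (bernsteinBasis_left hab hadm0 hk0)
      (bernsteinBasis_left hab hadm1 hk1)) ?_
    rw [iteratedDeriv_sub_of_infty _ hu hv, hu1, hv1, sub_self]
  have hPa := bernsteinBasis_left hab hadm hkP
  have huv : ContDiff ℝ ∞ (fun x => u x - v x) := hu.sub hv
  have hcP : ContDiff ℝ ∞ (fun x => c * P x) := contDiff_const.mul hP
  have hzero : ∀ x, u x - v x - c * P x = 0 :=
    eq_zero_of_vanishes_endpoints hab hadm (sub_mem_expPolySpace (sub_mem_expPolySpace hum hvm)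
      (const_mul_mem_expPolySpace c (bernsteinBasis_mem hab hadm hkP))) (k := k + 2)
      (l := R.length - k)
      (vanishesToOrder_succ (huva.sub huv hcP (hPa.const_mul c hP)) (by
        rw [iteratedDeriv_sub_of_infty _ huv hcP, iteratedDeriv_sub_of_infty _ hu hv,
          iteratedDeriv_const_mul_of_infty _ _ hP,
          iteratedDeriv_bernsteinBasis_left hab hadm hkP, hc]
        ring))
      ((hub.sub hu hv hvb).sub huv hcP (hPb.const_mul c hP))
      (by simp only [List.length_cons]; omega)
  have hDc : ((endCoeff a b ((lam0 : ℂ) :: R) k - endCoeff a b ((lam1 : ℂ) :: R) k : ℝ) : ℂ) =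
      c * endCoeff a b ((lam0 : ℂ) :: (lam1 : ℂ) :: R) (k + 1) := by
    have h1 : iteratedDeriv (R.length - k) (fun x => u x - v x - c * P x) b = 0 := by
      rw [show (fun x => u x - v x - c * P x) = fun _ => 0 from funext hzero]
      simp
    rw [iteratedDeriv_sub_of_infty _ huv hcP, iteratedDeriv_sub_of_infty _ hu hv,
      iteratedDeriv_const_mul_of_infty _ _ hP, hub1, hvb1, hPb1] at h1
    have h2 : ((-1 : ℂ) ^ (R.length - k)) ≠ 0 := pow_ne_zero _ (by norm_num)
    apply mul_left_cancel₀ h2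
    push_cast at h1 ⊢
    linear_combination h1
  rcases hk.lt_or_eq with hkR | hkR
  · have hQpos := endCoeff_pos hab hadmR hkR
    have hQ := contDiff_bernsteinBasis hab hadmR hkR
    have hstep : ∀ {r : ℝ}, Admissible a b ((r : ℂ) :: R) →
        iteratedDeriv (k + 1) (bernsteinBasis ((r : ℂ) :: R) a b k) a - r =
          iteratedDeriv k (prevBasis a b R k) a -
            ((endCoeff a b ((r : ℂ) :: R) k / endCoeff a b R k : ℝ) : ℂ) := by
      intro r hr
      have hk' : k < ((r : ℂ) :: R).length := by rw [List.length_cons]; omega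
      have h1 := iteratedDeriv_firstOrder k (r : ℂ) (contDiff_bernsteinBasis hab hr hk') a
      rw [iteratedDeriv_bernsteinBasis_left hab hr hk',
        show firstOrder r (bernsteinBasis ((r : ℂ) :: R) a b k) = _ from
          funext (firstOrder_bernsteinBasis hab hr hkR),
        iteratedDeriv_sub_of_infty _ (prevBasis_mem hab hr hk).1 (contDiff_const.mul hQ),
        iteratedDeriv_const_mul_of_infty _ _ hQ,
        iteratedDeriv_bernsteinBasis_left hab hadmR hkR] at h1
      linear_combination -h1
    have hs0 := hstep hadm0
    have hs1 := hstep hadm1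
    set D0 := endCoeff a b ((lam0 : ℂ) :: R) k
    set D1 := endCoeff a b ((lam1 : ℂ) :: R) k
    set DP := endCoeff a b ((lam0 : ℂ) :: (lam1 : ℂ) :: R) (k + 1)
    set DQ := endCoeff a b R k
    have hc' : c = ((lam0 - lam1 - (D0 / DQ - D1 / DQ) : ℝ) : ℂ) := by
      push_cast at hs0 hs1 ⊢
      linear_combination hc + hs0 - hs1
    rw [hc', ← Complex.ofReal_mul, Complex.ofReal_inj] at hDc
    -- This solves D0 - D1 = (λ₀ - λ₁ - (D0 - D1)/DQ) DP for D0 - D1.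
    refine ⟨DP / (1 + DP / DQ), by positivity, ?_⟩
    have : 0 < DQ + DP := by positivity
    field_simp at hDc ⊢
    linear_combination hDc
  -- For k equal to the length of R there is no p_{R,k}, so the correction term is absent and c = λ₀
  -- - λ₁.
  · have hstep : ∀ {r : ℝ}, Admissible a b ((r : ℂ) :: R) →
        iteratedDeriv (k + 1) (bernsteinBasis ((r : ℂ) :: R) a b k) a - r =
          iteratedDeriv k (prevBasis a b R k) a := by
      intro r hr
      have hk' : k < ((r : ℂ) :: R).length := by rw [List.length_cons]; omega
      have h1 := iteratedDeriv_firstOrder k (r : ℂ) (contDiff_bernsteinBasis hab hr hk') a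
      rw [iteratedDeriv_bernsteinBasis_left hab hr hk', hkR,
        show firstOrder r (bernsteinBasis ((r : ℂ) :: R) a b R.length) = _ from
          funext (firstOrder_bernsteinBasis_last hab hr)] at h1
      rw [hkR]
      linear_combination -h1
    have hc' : c = ((lam0 - lam1 : ℝ) : ℂ) := by
      push_cast
      linear_combination hc + hstep hadm0 - hstep hadm1
    rw [hc', ← Complex.ofReal_mul, Complex.ofReal_inj] at hDc
    exact ⟨_, hPpos, hDc⟩

lemma bernsteinNode_succ {k : ℕ} (hk : k ≤ R.length) :
    bernsteinNode a b lam0 lam1 R (k + 1) = bernsteinNode a b lam0 lam1 R k +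
      Real.log (endCoeff a b ((lam0 : ℂ) :: R) k / endCoeff a b ((lam1 : ℂ) :: R) k) /
        (lam0 - lam1) := by
  rw [bernsteinNode, boundaryLimit_bernsteinBasis hab (admissible_tail (admissible_swap hadm))
    (admissible_tail hadm) (by simp) (by rw [List.length_cons]; omega), Complex.ofReal_re]

lemma bernsteinNode_lt_succ (h01 : lam0 ≠ lam1) {k : ℕ} (hk : k ≤ R.length) :
    bernsteinNode a b lam0 lam1 R k < bernsteinNode a b lam0 lam1 R (k + 1) := by
  rw [bernsteinNode_succ hab hadm hk]
  have h0 := endCoeff_pos hab (admissible_tail (admissible_swap hadm)) (k := k)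
    (by rw [List.length_cons]; omega)
  have h1 := endCoeff_pos hab (admissible_tail hadm) (k := k)
    (by rw [List.length_cons]; omega)
  obtain ⟨c, hc, h⟩ := exists_endCoeff_sub_eq hab hadm hk
  refine lt_add_of_pos_right _ ?_
  rcases lt_or_gt_of_ne h01 with hlt | hgt
  · have hneg : (lam0 - lam1) * c < 0 := mul_neg_of_neg_of_pos (sub_neg.2 hlt) hc
    exact div_pos_of_neg_of_neg (Real.log_neg (div_pos h0 h1)
      ((div_lt_one h1).2 (by linarith))) (sub_neg.2 hlt)
  · have hpos : 0 < (lam0 - lam1) * c := mul_pos (sub_pos.2 hgt) hc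
    exact div_pos (Real.log_pos ((one_lt_div h1).2 (by linarith))) (sub_pos.2 hgt)

/-- The nodes relate the coefficients of the two exponentials fixed by the operator. -/
lemma expCoeff_eq_mul_exp (h01 : lam0 ≠ lam1) {k : ℕ} (hk : k ≤ R.length + 1) :
    expCoeff a b lam0 ((lam1 : ℂ) :: R) k = expCoeff a b lam1 ((lam0 : ℂ) :: R) k *
      Real.exp ((lam0 - lam1) * (bernsteinNode a b lam0 lam1 R k - a)) := by
  induction k with
  | zero => simp [expCoeff, bernsteinNode]
  | succ k ih =>
    have hk' : k ≤ R.length := by omega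
    have h0 := endCoeff_pos hab (admissible_tail (admissible_swap hadm)) (k := k)
      (by rw [List.length_cons]; omega)
    have h1 := endCoeff_pos hab (admissible_tail hadm) (k := k)
      (by rw [List.length_cons]; omega)
    have hne := sub_ne_zero.2 h01
    have he : Real.exp ((lam0 - lam1) * (bernsteinNode a b lam0 lam1 R (k + 1) - a)) =
        Real.exp ((lam0 - lam1) * (bernsteinNode a b lam0 lam1 R k - a)) *
          (endCoeff a b ((lam0 : ℂ) :: R) k / endCoeff a b ((lam1 : ℂ) :: R) k) := by
      rw [bernsteinNode_succ hab hadm hk']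
      have hq := div_pos h0 h1
      set q := endCoeff a b ((lam0 : ℂ) :: R) k / endCoeff a b ((lam1 : ℂ) :: R) k
      rw [show (lam0 - lam1) * (bernsteinNode a b lam0 lam1 R k + Real.log q / (lam0 - lam1) - a) =
        (lam0 - lam1) * (bernsteinNode a b lam0 lam1 R k - a) + Real.log q by field_simp; ring,
        Real.exp_add, Real.exp_log hq]
    have ih' := ih (by omega)
    have hs : ∀ μ Λ, expCoeff a b μ Λ (k + 1) =
        expCoeff a b μ Λ k * (endCoeff a b (μ :: Λ) k / endCoeff a b Λ k) := fun μ Λ => by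
      rw [expCoeff, Finset.prod_range_succ, ← expCoeff]
    rw [hs, hs, he, ih', endCoeff_perm (List.Perm.swap (lam0 : ℂ) (lam1 : ℂ) R)]
    field_simp

lemma bernsteinBasis_right_eq_zero {k : ℕ} (hk : k < R.length + 1) :
    bernsteinBasis ((lam0 : ℂ) :: (lam1 : ℂ) :: R) a b k b = 0 := by
  have := bernsteinBasis_right hab hadm (k := k) (by simp only [List.length_cons]; omega) 0
    (by simp only [List.length_cons]; omega)
  rwa [iteratedDeriv_zero] at this

lemma exp_right_eq : Complex.exp (lam0 * (b - a)) =
    expCoeff a b lam0 ((lam1 : ℂ) :: R) (R.length + 1) *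
      bernsteinBasis ((lam0 : ℂ) :: (lam1 : ℂ) :: R) a b (R.length + 1) b := by
  rw [exp_eq_sum_bernsteinBasis hab hadm, List.length_cons, Finset.sum_range_succ,
    Finset.sum_eq_zero, zero_add]
  intro k hk
  rw [bernsteinBasis_right_eq_zero hab hadm (Finset.mem_range.1 hk), mul_zero]

/-- At b only the last basis function survives, so the quotient of the two exponentials at b is the
quotient of their last coefficients, exp((λ₀ - λ₁)(t - a)) with t the last node. -/
lemma bernsteinNode_last (h01 : lam0 ≠ lam1) :
    bernsteinNode a b lam0 lam1 R (R.length + 1) = b := by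
  have h0 := exp_right_eq hab hadm
  have h1 := exp_right_eq hab (admissible_swap hadm)
  rw [expCoeff_eq_mul_exp hab hadm h01 le_rfl,
    bernsteinBasis_perm (List.Perm.swap (lam1 : ℂ) (lam0 : ℂ) R)] at h0
  set t := bernsteinNode a b lam0 lam1 R (R.length + 1)
  have h2 : Real.exp (lam0 * (b - a)) =
      Real.exp (lam1 * (b - a)) * Real.exp ((lam0 - lam1) * (t - a)) := by
    apply Complex.ofReal_injective
    push_cast at h0 h1 ⊢
    rw [h0, h1]
    ring
  rw [← Real.exp_add, Real.exp_eq_exp] at h2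
  have h3 : (lam0 - lam1) * (t - b) = 0 := by linear_combination -h2
  exact sub_eq_zero.1 ((mul_eq_zero.1 h3).resolve_left (sub_ne_zero.2 h01))

lemma bernsteinNode_mono (h01 : lam0 ≠ lam1) {j k : ℕ} (hjk : j ≤ k) (hk : k ≤ R.length + 1) :
    bernsteinNode a b lam0 lam1 R j ≤ bernsteinNode a b lam0 lam1 R k := by
  induction k, hjk using Nat.le_induction with
  | base => exact le_rfl
  | succ k _ ih =>
    exact (ih (by omega)).trans (bernsteinNode_lt_succ hab hadm h01 (by omega)).le

lemma bernsteinNode_mem_Icc (h01 : lam0 ≠ lam1) {k : ℕ} (hk : k ≤ R.length + 1) :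
    bernsteinNode a b lam0 lam1 R k ∈ Set.Icc a b := by
  constructor
  · exact bernsteinNode_mono hab hadm h01 (Nat.zero_le k) hk
  · have := bernsteinNode_mono hab hadm h01 hk le_rfl
    rwa [bernsteinNode_last hab hadm h01] at this

lemma bernsteinCoeff_eq {k : ℕ} (hk : k ≤ R.length + 1) :
    bernsteinCoeff a b lam0 lam1 R k =
      ((Real.exp (-lam0 * (bernsteinNode a b lam0 lam1 R k - a)) *
        expCoeff a b lam0 ((lam1 : ℂ) :: R) k : ℝ) : ℂ) := by
  rw [bernsteinCoeff, Finset.prod_congr rfl (fun l hl => boundaryLimit_deriv_bernsteinBasis hab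
    hadm (admissible_tail hadm) (k := l) (by
      have := Finset.mem_range.1 hl
      rw [List.length_cons]; omega)), ← Complex.ofReal_prod, Finset.prod_neg, Finset.card_range,
    ← expCoeff]
  push_cast
  rw [mul_assoc, ← mul_assoc ((-1 : ℂ) ^ k), ← mul_pow]
  simp

end Nodes

/-! ### The Korovkin estimate. -/

/-- A combination of `1`, `exp (m₁ z)`, `exp (m₂ z)` with a double zero at `0`. -/
noncomputable def expPeak (m₁ m₂ z : ℝ) : ℝ :=
  ((Real.exp (m₂ * z) - 1) / m₂ - (Real.exp (m₁ * z) - 1) / m₁) / (m₂ - m₁)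

section Peak

variable {m₁ m₂ : ℝ} (h₁ : m₁ ≠ 0) (h₂ : m₂ ≠ 0) (h₁₂ : m₁ ≠ m₂)

include h₁ h₂

lemma hasDerivAt_expPeak (z : ℝ) :
    HasDerivAt (expPeak m₁ m₂) ((Real.exp (m₂ * z) - Real.exp (m₁ * z)) / (m₂ - m₁)) z := by
  have h : ∀ m : ℝ, m ≠ 0 → HasDerivAt (fun z => (Real.exp (m * z) - 1) / m) (Real.exp (m * z)) z :=
    fun m hm => by
      have := ((((hasDerivAt_id z).const_mul m).exp).sub_const 1).div_const m
      refine this.congr_deriv ?_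
      simp only [id, mul_one]
      field_simp
  exact ((h m₂ h₂).sub (h m₁ h₁)).div_const _

include h₁₂

/-- The derivative is a difference quotient of m ↦ exp(m z), which has the sign of z. -/
lemma strictMonoOn_expPeak : StrictMonoOn (expPeak m₁ m₂) (Set.Ici 0) := by
  refine strictMonoOn_of_deriv_pos (convex_Ici 0)
    (fun z _ => (hasDerivAt_expPeak h₁ h₂ z).continuousAt.continuousWithinAt) fun z hz => ?_
  rw [interior_Ici, Set.mem_Ioi] at hz
  rw [(hasDerivAt_expPeak h₁ h₂ z).deriv]
  rcases lt_or_gt_of_ne h₁₂ with h | h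
  · exact div_pos (sub_pos.2 (Real.exp_lt_exp.2 (mul_lt_mul_of_pos_right h hz))) (sub_pos.2 h)
  · exact div_pos_of_neg_of_neg
      (sub_neg.2 (Real.exp_lt_exp.2 (mul_lt_mul_of_pos_right h hz))) (sub_neg.2 h)

lemma strictAntiOn_expPeak : StrictAntiOn (expPeak m₁ m₂) (Set.Iic 0) := by
  refine strictAntiOn_of_deriv_neg (convex_Iic 0)
    (fun z _ => (hasDerivAt_expPeak h₁ h₂ z).continuousAt.continuousWithinAt) fun z hz => ?_
  rw [interior_Iic, Set.mem_Iio] at hz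
  rw [(hasDerivAt_expPeak h₁ h₂ z).deriv]
  rcases lt_or_gt_of_ne h₁₂ with h | h
  · exact div_neg_of_neg_of_pos
      (sub_neg.2 (Real.exp_lt_exp.2 (mul_lt_mul_of_neg_right h hz))) (sub_pos.2 h)
  · exact div_neg_of_pos_of_neg
      (sub_pos.2 (Real.exp_lt_exp.2 (mul_lt_mul_of_neg_right h hz))) (sub_neg.2 h)

lemma expPeak_nonneg (z : ℝ) : 0 ≤ expPeak m₁ m₂ z := by
  have h0 : expPeak m₁ m₂ 0 = 0 := by simp [expPeak]
  rw [← h0]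
  rcases le_total 0 z with hz | hz
  · exact (strictMonoOn_expPeak h₁ h₂ h₁₂).monotoneOn Set.self_mem_Ici hz hz
  · exact (strictAntiOn_expPeak h₁ h₂ h₁₂).antitoneOn hz Set.self_mem_Iic hz

lemma exists_le_expPeak {η : ℝ} (hη : 0 < η) : ∃ m > 0, ∀ z, η ≤ |z| → m ≤ expPeak m₁ m₂ z := by
  have h0 : expPeak m₁ m₂ 0 = 0 := by simp [expPeak]
  have hmono := strictMonoOn_expPeak h₁ h₂ h₁₂
  have hanti := strictAntiOn_expPeak h₁ h₂ h₁₂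
  have hη' : -η ≤ 0 := by linarith
  refine ⟨min (expPeak m₁ m₂ η) (expPeak m₁ m₂ (-η)), lt_min ?_ ?_, fun z hz => ?_⟩
  · rw [← h0]
    exact hmono Set.self_mem_Ici hη.le hη
  · rw [← h0]
    exact hanti hη' Set.self_mem_Iic (by linarith)
  · rcases le_abs'.1 hz with h | h
    · exact (min_le_right _ _).trans (hanti.antitoneOn (h.trans hη') hη' h)
    · exact (min_le_left _ _).trans (hmono.monotoneOn hη.le (hη.le.trans h) h)

/-- A quantitative Korovkin theorem for averages reproducing `1` and `exp (m₁ x)`. -/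
lemma exists_korovkin_bound {a b : ℝ} {f : ℝ → ℂ} (hf : ContinuousOn f (Set.Icc a b)) {ε : ℝ}
    (hε : 0 < ε) : ∃ δ > 0, ∀ (s : Finset ℕ) (w t : ℕ → ℝ) (x : ℝ), x ∈ Set.Icc a b →
      (∀ k ∈ s, 0 ≤ w k ∧ t k ∈ Set.Icc a b) → ∑ k ∈ s, w k = 1 →
      ∑ k ∈ s, w k * Real.exp (m₁ * (t k - x)) = 1 →
      |∑ k ∈ s, w k * Real.exp (m₂ * (t k - x)) - 1| ≤ δ →
      ‖∑ k ∈ s, (w k : ℂ) * f (t k) - f x‖ ≤ ε := by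
  obtain ⟨K, hK⟩ := isCompact_Icc.exists_bound_of_continuousOn hf
  obtain ⟨η, hη, hunif⟩ := Metric.uniformContinuousOn_iff.1
    (isCompact_Icc.uniformContinuousOn_of_continuous hf) (ε / 2) (by positivity)
  obtain ⟨m, hm, hpeak⟩ := exists_le_expPeak h₁ h₂ h₁₂ hη
  set C : ℝ := 2 * |K| / m
  have hC : 0 ≤ C := by positivity
  set q : ℝ := |m₂ * (m₂ - m₁)|
  have hq : 0 < q := abs_pos.2 (mul_ne_zero h₂ (sub_ne_zero.2 h₁₂.symm))
  -- As 1 and exp(m₁ ·) are reproduced exactly, the average of the peak is the defect for m₂ divided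
  -- by m₂(m₂ - m₁). This δ bounds it by (ε/2)/(C + 1), where C makes C times the peak dominate the
  -- oscillation of f at distance at least η. The δ does not depend on the weights, nodes or x.
  refine ⟨ε / 2 * q / (C + 1), by positivity, fun s w t x hx hw hw1 hwm₁ hwm₂ => ?_⟩
  have hbound : ∀ y ∈ Set.Icc a b, ‖f y - f x‖ ≤ ε / 2 + C * expPeak m₁ m₂ (y - x) := by
    intro y hy
    rcases lt_or_ge |y - x| η with h | h
    · have h1 := hunif y hy x hx (by rwa [Real.dist_eq])
      rw [dist_eq_norm] at h1
      have := mul_nonneg hC (expPeak_nonneg h₁ h₂ h₁₂ (y - x))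
      linarith
    · have h1 : ‖f y - f x‖ ≤ 2 * |K| := by
        refine (norm_sub_le _ _).trans ?_
        linarith [hK y hy, hK x hx, le_abs_self K]
      have h2 : C * m ≤ C * expPeak m₁ m₂ (y - x) := mul_le_mul_of_nonneg_left (hpeak _ h) hC
      have h3 : C * m = 2 * |K| := div_mul_cancel₀ _ hm.ne'
      linarith
  have hsum : ∑ k ∈ s, w k * expPeak m₁ m₂ (t k - x) =
      (∑ k ∈ s, w k * Real.exp (m₂ * (t k - x)) - 1) / (m₂ * (m₂ - m₁)) := by
    have : ∀ k, w k * expPeak m₁ m₂ (t k - x) = (w k * Real.exp (m₂ * (t k - x)) - w k) /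
        (m₂ * (m₂ - m₁)) - (w k * Real.exp (m₁ * (t k - x)) - w k) / (m₁ * (m₂ - m₁)) := by
      intro k
      have := sub_ne_zero.2 h₁₂.symm
      rw [expPeak]
      field_simp
    simp only [this, Finset.sum_sub_distrib, ← Finset.sum_div, hw1, hwm₁]
    simp
  have hsum_le : ∑ k ∈ s, w k * expPeak m₁ m₂ (t k - x) ≤ ε / 2 / (C + 1) := by
    rw [hsum]
    refine (le_abs_self _).trans ?_
    rw [abs_div, div_le_iff₀ hq]
    calc _ ≤ _ := hwm₂
      _ = _ := by ring
  have hsplit : ∑ k ∈ s, (w k : ℂ) * f (t k) - f x = ∑ k ∈ s, (w k : ℂ) * (f (t k) - f x) := by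
    simp only [mul_sub, Finset.sum_sub_distrib, ← Finset.sum_mul]
    rw [← Complex.ofReal_sum, hw1]
    simp
  rw [hsplit]
  calc ‖∑ k ∈ s, (w k : ℂ) * (f (t k) - f x)‖
      ≤ ∑ k ∈ s, w k * (ε / 2 + C * expPeak m₁ m₂ (t k - x)) := by
        refine norm_sum_le_of_le s fun k hk => ?_
        rw [norm_mul, Complex.norm_real, Real.norm_of_nonneg (hw k hk).1]
        exact mul_le_mul_of_nonneg_left (hbound _ (hw k hk).2) (hw k hk).1
    _ = ε / 2 + C * ∑ k ∈ s, w k * expPeak m₁ m₂ (t k - x) := by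
        simp only [mul_add, Finset.sum_add_distrib, ← Finset.sum_mul, hw1, one_mul,
          Finset.mul_sum]
        congr 1
        exact Finset.sum_congr rfl fun k _ => by ring
    _ ≤ ε / 2 + C * (ε / 2 / (C + 1)) := by gcongr
    _ ≤ ε := by
        have : C * (ε / 2 / (C + 1)) ≤ ε / 2 := by
          rw [mul_div_assoc', div_le_iff₀ (by positivity)]
          nlinarith
        linarith

end Peak

/-! ### The operator as an average with respect to nonnegative weights. -/

/-- The mass that the Bernstein operator, conjugated by `exp (λ₀ x)`, places at the `k`-th node. -/
noncomputable def bernsteinWeight (a b lam0 lam1 : ℝ) (R : List ℂ) (x : ℝ) (k : ℕ) : ℝ :=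
  expCoeff a b lam0 ((lam1 : ℂ) :: R) k *
    (bernsteinBasis ((lam0 : ℂ) :: (lam1 : ℂ) :: R) a b k x).re * Real.exp (-lam0 * (x - a))

section Weights

variable {a b : ℝ} (hab : a < b) {R : List ℂ} {lam0 lam1 : ℝ}
  (hadm : Admissible a b ((lam0 : ℂ) :: (lam1 : ℂ) :: R))

include hab hadm

lemma bernsteinWeight_nonneg {x : ℝ} (hx : x ∈ Set.Icc a b) {k : ℕ} (hk : k < R.length + 2) :
    0 ≤ bernsteinWeight a b lam0 lam1 R x k :=
  mul_nonneg (mul_nonneg (expCoeff_pos hab hadm (by rw [List.length_cons]; omega)).le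
    (bernsteinBasis_re_nonneg hab hadm (by simpa only [List.length_cons] using hk) hx))
    (Real.exp_pos _).le

lemma ofReal_bernsteinBasis_re {k : ℕ} (hk : k < R.length + 2) (x : ℝ) :
    ((bernsteinBasis ((lam0 : ℂ) :: (lam1 : ℂ) :: R) a b k x).re : ℂ) =
      bernsteinBasis ((lam0 : ℂ) :: (lam1 : ℂ) :: R) a b k x :=
  Complex.ext rfl (by simpa using (realValued_bernsteinBasis hab hadm
    (by simpa only [List.length_cons] using hk) x).symm)

/-- The weights integrate the exponential of any real eigenvalue `μ`, given the coefficients of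
that exponential relative to those of `exp (λ₀ x)`. -/
lemma sum_bernsteinWeight_mul {μ : ℝ} {Λ : List ℂ}
    (hp : ((lam0 : ℂ) :: (lam1 : ℂ) :: R).Perm ((μ : ℂ) :: Λ)) {ρ : ℕ → ℝ}
    (hρ : ∀ k < R.length + 2,
      expCoeff a b lam0 ((lam1 : ℂ) :: R) k * ρ k = expCoeff a b μ Λ k) (x : ℝ) :
    ∑ k ∈ Finset.range (R.length + 2), bernsteinWeight a b lam0 lam1 R x k * ρ k =
      Real.exp ((μ - lam0) * (x - a)) := by
  have hlen : R.length + 2 = Λ.length + 1 := by simpa using hp.length_eq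
  have h := exp_eq_sum_bernsteinBasis hab (hadm.perm hp) x
  rw [← hlen, ← bernsteinBasis_perm hp] at h
  have h' : Real.exp (μ * (x - a)) = ∑ k ∈ Finset.range (R.length + 2),
      expCoeff a b μ Λ k * (bernsteinBasis ((lam0 : ℂ) :: (lam1 : ℂ) :: R) a b k x).re := by
    apply Complex.ofReal_injective
    push_cast
    rw [h]
    exact Finset.sum_congr rfl fun k hk => by
      rw [ofReal_bernsteinBasis_re hab hadm (Finset.mem_range.1 hk)]
  rw [show (μ - lam0) * (x - a) = μ * (x - a) + -lam0 * (x - a) by ring, Real.exp_add, h',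
    Finset.sum_mul]
  refine Finset.sum_congr rfl fun k hk => ?_
  rw [← hρ k (Finset.mem_range.1 hk), bernsteinWeight]
  ring

lemma sum_bernsteinWeight (x : ℝ) :
    ∑ k ∈ Finset.range (R.length + 2), bernsteinWeight a b lam0 lam1 R x k = 1 := by
  have := sum_bernsteinWeight_mul hab hadm (List.Perm.refl _) (ρ := fun _ => 1)
    (fun k _ => mul_one _) x
  simpa using this

lemma sum_bernsteinWeight_mul_exp (h01 : lam0 ≠ lam1) (x : ℝ) :
    ∑ k ∈ Finset.range (R.length + 2), bernsteinWeight a b lam0 lam1 R x k *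
      Real.exp ((lam1 - lam0) * (bernsteinNode a b lam0 lam1 R k - x)) = 1 := by
  have h := sum_bernsteinWeight_mul hab hadm (List.Perm.swap _ _ _)
    (ρ := fun k => Real.exp ((lam1 - lam0) * (bernsteinNode a b lam0 lam1 R k - a)))
    (fun k hk => by
      rw [expCoeff_eq_mul_exp hab hadm h01 (by omega), mul_assoc, ← Real.exp_add]
      ring_nf
      simp) x
  calc _ = (∑ k ∈ Finset.range (R.length + 2), bernsteinWeight a b lam0 lam1 R x k *
        Real.exp ((lam1 - lam0) * (bernsteinNode a b lam0 lam1 R k - a))) *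
          Real.exp (-((lam1 - lam0) * (x - a))) := by
        rw [Finset.sum_mul]
        refine Finset.sum_congr rfl fun k _ => ?_
        rw [mul_assoc, ← Real.exp_add]
        ring_nf
    _ = 1 := by rw [h, ← Real.exp_add]; simp

lemma bernsteinOp_eq (f : ℝ → ℂ) (x : ℝ) :
    bernsteinOp a b lam0 lam1 R f x = (Real.exp (lam0 * (x - a)) : ℂ) *
      ∑ k ∈ Finset.range (R.length + 2), (bernsteinWeight a b lam0 lam1 R x k : ℂ) *
        ((Real.exp (-lam0 * (bernsteinNode a b lam0 lam1 R k - a)) : ℂ) *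
          f (bernsteinNode a b lam0 lam1 R k)) := by
  rw [bernsteinOp, Finset.mul_sum]
  refine Finset.sum_congr rfl fun k hk => ?_
  have hk' := Finset.mem_range.1 hk
  have he : (Real.exp (lam0 * (x - a)) : ℂ) * (Real.exp (-lam0 * (x - a)) : ℂ) = 1 := by
    rw [← Complex.ofReal_mul, ← Real.exp_add]
    simp
  rw [bernsteinCoeff_eq hab hadm (by omega), bernsteinWeight]
  simp only [Complex.ofReal_mul]
  rw [ofReal_bernsteinBasis_re hab hadm hk']
  linear_combination (-(Real.exp (-lam0 * (bernsteinNode a b lam0 lam1 R k - a)) : ℂ) *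
    expCoeff a b lam0 ((lam1 : ℂ) :: R) k * f (bernsteinNode a b lam0 lam1 R k) *
    bernsteinBasis ((lam0 : ℂ) :: (lam1 : ℂ) :: R) a b k x) * he

end Weights

/-! ### Approximate reproduction of the third exponential. -/

section Ratio

lemma perm_rotate (x y z : ℂ) (T : List ℂ) : (x :: y :: z :: T).Perm (z :: x :: y :: T) :=
  ((List.Perm.swap z y T).cons x).trans (List.Perm.swap z x (y :: T))

variable {a b : ℝ} (hab : a < b) {T : List ℂ} {lam0 lam1 lam2 : ℝ}
  (hadm : Admissible a b ((lam0 : ℂ) :: (lam1 : ℂ) :: (lam2 : ℂ) :: T))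

include hadm

lemma admissible_ratio : Admissible a b ((lam0 : ℂ) :: (lam1 : ℂ) :: T) :=
  (hadm.perm (perm_rotate _ _ _ _)).of_cons (Complex.ofReal_im _)

include hab

lemma ratioB_eq {k : ℕ} (hk : k < T.length + 2) : ratioB a b lam0 lam1 lam2 T k =
    endCoeff a b ((lam0 : ℂ) :: (lam1 : ℂ) :: T) k /
      endCoeff a b ((lam1 : ℂ) :: (lam2 : ℂ) :: T) k := by
  rw [ratioB, boundaryLimit_bernsteinBasis hab (admissible_ratio hadm)
    (admissible_tail hadm) (by simp) (by simpa only [List.length_cons] using hk), Complex.ofReal_re]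

lemma ratioB_pos {k : ℕ} (hk : k < T.length + 2) : 0 < ratioB a b lam0 lam1 lam2 T k := by
  rw [ratioB_eq hab hadm hk]
  exact div_pos (endCoeff_pos hab (admissible_ratio hadm) (by simpa only [List.length_cons] using hk))
    (endCoeff_pos hab (admissible_tail hadm) (by simpa only [List.length_cons] using hk))

/-- The coefficients of e_{λ₂} and e_{λ₀} share the numerators D_Λ(l), so their quotient is the
product of 1/b(n,l) over l < k. -/
lemma sum_bernsteinWeight_mul_ratioB (x : ℝ) :
    ∑ k ∈ Finset.range (T.length + 3), bernsteinWeight a b lam0 lam1 ((lam2 : ℂ) :: T) x k *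
      Real.exp (-∑ l ∈ Finset.range k, Real.log (ratioB a b lam0 lam1 lam2 T l)) =
        Real.exp ((lam2 - lam0) * (x - a)) := by
  refine sum_bernsteinWeight_mul hab hadm (perm_rotate _ _ _ _) (fun k hk => ?_) x
  rw [List.length_cons] at hk
  rw [← Finset.sum_neg_distrib, Real.exp_sum, expCoeff, expCoeff, ← Finset.prod_mul_distrib]
  refine Finset.prod_congr rfl fun l hl => ?_
  have hl' : l < T.length + 2 := by have := Finset.mem_range.1 hl; omega
  have h1 := endCoeff_pos hab (admissible_ratio hadm) (k := l) (by simpa only [List.length_cons] using hl')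
  have h2 := endCoeff_pos hab (admissible_tail hadm) (k := l) (by simpa only [List.length_cons] using hl')
  rw [Real.exp_neg, Real.exp_log (ratioB_pos hab hadm hl'), ratioB_eq hab hadm hl',
    endCoeff_perm (perm_rotate (lam0 : ℂ) lam1 lam2 T)]
  field_simp

/-- If the logarithmic ratios are within `ε` of their limit, then the weights almost reproduce
`exp ((λ₂ - λ₀) x)`. -/
lemma abs_sum_bernsteinWeight_sub_one_le (h01 : lam0 ≠ lam1) {ε : ℝ} (hε : 0 ≤ ε)
    (hlog : ∀ k < T.length + 2, |Real.log (ratioB a b lam0 lam1 lam2 T k) /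
      (bernsteinNode a b lam0 lam1 ((lam2 : ℂ) :: T) k -
        bernsteinNode a b lam0 lam1 ((lam2 : ℂ) :: T) (k + 1)) - (lam2 - lam0)| ≤ ε)
    {x : ℝ} (hx : x ∈ Set.Icc a b) :
    |∑ k ∈ Finset.range (T.length + 3), bernsteinWeight a b lam0 lam1 ((lam2 : ℂ) :: T) x k *
      Real.exp ((lam2 - lam0) * (bernsteinNode a b lam0 lam1 ((lam2 : ℂ) :: T) k - x)) - 1| ≤
        Real.exp (ε * (b - a)) - 1 := by
  set t := bernsteinNode a b lam0 lam1 ((lam2 : ℂ) :: T) with ht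
  set L : ℕ → ℝ := fun k => -∑ l ∈ Finset.range k, Real.log (ratioB a b lam0 lam1 lam2 T l)
  set w := bernsteinWeight a b lam0 lam1 ((lam2 : ℂ) :: T) x
  -- Multiplied by the step length, the error is ε times that step, so the accumulated error
  -- telescopes to ε(t_k - a) ≤ ε(b - a), whatever the number of nodes.
  have hstep : ∀ k < T.length + 2,
      |(lam2 - lam0) * (t (k + 1) - t k) + Real.log (ratioB a b lam0 lam1 lam2 T k)| ≤
        ε * (t (k + 1) - t k) := by
    intro k hk
    have hpos : 0 < t (k + 1) - t k :=
      sub_pos.2 (bernsteinNode_lt_succ hab hadm h01 (by rw [List.length_cons]; omega))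
    have h1 := mul_le_mul_of_nonneg_right (hlog k hk) hpos.le
    have h2 : t k - t (k + 1) ≠ 0 := by linarith
    have h3 : (lam2 - lam0) * (t (k + 1) - t k) + Real.log (ratioB a b lam0 lam1 lam2 T k) =
        -((Real.log (ratioB a b lam0 lam1 lam2 T k) / (t k - t (k + 1)) - (lam2 - lam0)) *
          (t (k + 1) - t k)) := by
      field_simp
      ring
    rwa [h3, abs_neg, abs_mul, abs_of_pos hpos]
  have hacc : ∀ k ≤ T.length + 2, |(lam2 - lam0) * (t k - a) - L k| ≤ ε * (t k - a) := by
    intro k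
    induction k with
    | zero => intro _; simp [L, ht, bernsteinNode]
    | succ k ih =>
      intro hk
      have h1 := ih (by omega)
      have h2 := hstep k (by omega)
      have h3 : L (k + 1) = L k - Real.log (ratioB a b lam0 lam1 lam2 T k) := by
        simp only [L, Finset.sum_range_succ]; ring
      calc |(lam2 - lam0) * (t (k + 1) - a) - L (k + 1)|
          = |((lam2 - lam0) * (t k - a) - L k) +
              ((lam2 - lam0) * (t (k + 1) - t k) +
                Real.log (ratioB a b lam0 lam1 lam2 T k))| := by
            rw [h3]; congr 1; ring
        _ ≤ ε * (t k - a) + ε * (t (k + 1) - t k) := (abs_add_le _ _).trans (add_le_add h1 h2)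
        _ = ε * (t (k + 1) - a) := by ring
  -- With `L k` in place of (λ₂ - λ₀)(t_k - a) the reproduction is exact; this sum is the reference
  -- for the comparison.
  have hone : ∑ k ∈ Finset.range (T.length + 3),
      w k * Real.exp (L k - (lam2 - lam0) * (x - a)) = 1 := by
    have h := sum_bernsteinWeight_mul_ratioB hab hadm x
    calc _ = (∑ k ∈ Finset.range (T.length + 3), w k * Real.exp (L k)) *
          Real.exp (-((lam2 - lam0) * (x - a))) := by
          rw [Finset.sum_mul]
          refine Finset.sum_congr rfl fun k _ => ?_
          rw [mul_assoc, ← Real.exp_add]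
          ring_nf
      _ = 1 := by rw [h, ← Real.exp_add]; simp
  have hexp : ∀ {y d : ℝ}, |y| ≤ d → |Real.exp y - 1| ≤ Real.exp d - 1 := by
    intro y d hy
    have hy' := abs_le.1 hy
    have h1 := Real.exp_le_exp.2 hy'.2
    have h2 := Real.exp_le_exp.2 hy'.1
    have h3 : Real.exp d * Real.exp (-d) = 1 := by rw [← Real.exp_add]; simp
    have h4 := Real.exp_pos d
    rw [abs_le]
    refine ⟨?_, by linarith⟩
    -- The lower bound amounts to exp d + exp(-d) ≥ 2.
    nlinarith [sq_nonneg (Real.exp d - 1), Real.exp_pos (-d)]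
  rw [← hone, ← Finset.sum_sub_distrib]
  calc |∑ k ∈ Finset.range (T.length + 3), (w k * Real.exp ((lam2 - lam0) * (t k - x)) -
          w k * Real.exp (L k - (lam2 - lam0) * (x - a)))|
      ≤ ∑ k ∈ Finset.range (T.length + 3), w k * Real.exp (L k - (lam2 - lam0) * (x - a)) *
          (Real.exp (ε * (b - a)) - 1) := by
        refine (Finset.abs_sum_le_sum_abs _ _).trans (Finset.sum_le_sum fun k hk => ?_)
        have hk' : k < T.length + 3 := Finset.mem_range.1 hk
        have hw : 0 ≤ w k := bernsteinWeight_nonneg hab hadm hx (by rw [List.length_cons]; omega)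
        have h1 : w k * Real.exp ((lam2 - lam0) * (t k - x)) -
            w k * Real.exp (L k - (lam2 - lam0) * (x - a)) =
            w k * Real.exp (L k - (lam2 - lam0) * (x - a)) *
              (Real.exp ((lam2 - lam0) * (t k - a) - L k) - 1) := by
          rw [show (lam2 - lam0) * (t k - x) = L k - (lam2 - lam0) * (x - a) +
            ((lam2 - lam0) * (t k - a) - L k) by ring, Real.exp_add]
          ring
        have htk : t k ≤ b :=
          (bernsteinNode_mem_Icc hab hadm h01 (by rw [List.length_cons]; omega)).2
        rw [h1, abs_mul, abs_of_nonneg (mul_nonneg hw (Real.exp_pos _).le)]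
        refine mul_le_mul_of_nonneg_left (hexp ((hacc k (by omega)).trans ?_))
          (mul_nonneg hw (Real.exp_pos _).le)
        exact mul_le_mul_of_nonneg_left (by linarith) hε
    _ = _ := by rw [← Finset.sum_mul, hone, one_mul]

end Ratio

/-! ### Uniform convergence. -/

/-- `T n` is the list `(λ₃, …, λₙ)` of the eigenvalues that may vary with `n`. -/
theorem theorem4p2 (a b : ℝ) (hab : a < b) (lam0 lam1 lam2 : ℝ)
    (h01 : lam0 ≠ lam1) (h02 : lam0 ≠ lam2) (h12 : lam1 ≠ lam2)
    (T : ℕ → List ℂ) (hT : ∀ n, 2 ≤ n → (T n).length + 2 = n)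
    (hconj : ∀ n, 2 ≤ n →
      ClosedUnderConj (expPolySpace ((lam0 : ℂ) :: (lam1 : ℂ) :: (lam2 : ℂ) :: T n)))
    (M : ℝ) (hM : 0 < M)
    (hIm : ∀ n, 2 ≤ n → ∀ μ ∈ (lam0 : ℂ) :: (lam1 : ℂ) :: (lam2 : ℂ) :: T n, |μ.im| ≤ M)
    (hlength : ∀ n, 2 ≤ n → ∀ μ ∈ (lam0 : ℂ) :: (lam1 : ℂ) :: (lam2 : ℂ) :: T n,
      |μ.im| * (b - a) < Real.pi)
    (hmesh : ∀ ε > 0, ∃ n₀ : ℕ, ∀ n ≥ n₀, ∀ k < n,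
      |bernsteinNode a b lam0 lam1 ((lam2 : ℂ) :: T n) (k + 1) -
        bernsteinNode a b lam0 lam1 ((lam2 : ℂ) :: T n) k| < ε)
    (hlog : ∀ ε > 0, ∃ n₀ : ℕ, ∀ n ≥ n₀, ∀ k < n,
      |Real.log (ratioB a b lam0 lam1 lam2 (T n) k) /
          (bernsteinNode a b lam0 lam1 ((lam2 : ℂ) :: T n) k -
            bernsteinNode a b lam0 lam1 ((lam2 : ℂ) :: T n) (k + 1)) -
        (lam2 - lam0)| < ε)
    (f : ℝ → ℂ) (hf : ContinuousOn f (Set.Icc a b)) :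
    TendstoUniformlyOn (fun n x => bernsteinOp a b lam0 lam1 ((lam2 : ℂ) :: T n) f x)
      f atTop (Set.Icc a b) := by
  have hadm : ∀ n, 2 ≤ n →
      Admissible a b ((lam0 : ℂ) :: (lam1 : ℂ) :: (lam2 : ℂ) :: T n) := fun n hn =>
    ⟨perm_map_conj_of_closedUnderConj (hconj n hn), hlength n hn⟩
  -- The averages act on g = f / e_{λ₀}; the Korovkin exponents are then λ₁ - λ₀ and λ₂ - λ₀,
  -- nonzero and distinct.
  set g : ℝ → ℂ := fun s => (Real.exp (-lam0 * (s - a)) : ℂ) * f s with hg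
  have hgc : ContinuousOn g (Set.Icc a b) := by
    refine ContinuousOn.mul (Continuous.continuousOn ?_) hf
    fun_prop
  rw [Metric.tendstoUniformlyOn_iff]
  intro ε hε
  set C : ℝ := Real.exp (|lam0| * (b - a))
  have hC : 0 < C := Real.exp_pos _
  obtain ⟨δ, hδ, hkor⟩ := exists_korovkin_bound (sub_ne_zero.2 h01.symm)
    (sub_ne_zero.2 h02.symm) (fun h => h12 (by linarith)) hgc
    (show 0 < ε / 2 / C by positivity)
  have hba : 0 < b - a := sub_pos.2 hab
  -- Chosen so that exp(η(b - a)) - 1 = δ.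
  set η : ℝ := Real.log (1 + δ) / (b - a)
  have hη : 0 < η := div_pos (Real.log_pos (by linarith)) hba
  obtain ⟨n₀, hn₀⟩ := hlog η hη
  filter_upwards [eventually_ge_atTop n₀, eventually_ge_atTop 2] with n hn hn2 x hx
  have hA := hadm n hn2
  have hTn := hT n hn2
  have hlen : ((lam2 : ℂ) :: T n).length + 2 = (T n).length + 3 := by rw [List.length_cons]
  have hη' : Real.exp (η * (b - a)) - 1 = δ := by
    rw [div_mul_cancel₀ _ hba.ne', Real.exp_log (by linarith)]
    ring
  have h2 := abs_sum_bernsteinWeight_sub_one_le hab hA h01 hη.le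
    (fun k hk => (hn₀ n hn k (by omega)).le) hx
  rw [hη', ← hlen] at h2
  have h3 := hkor _ _ (bernsteinNode a b lam0 lam1 ((lam2 : ℂ) :: T n)) x hx
    (fun k hk => ⟨bernsteinWeight_nonneg hab hA hx (Finset.mem_range.1 hk),
      bernsteinNode_mem_Icc hab hA h01 (by have := Finset.mem_range.1 hk; omega)⟩)
    (sum_bernsteinWeight hab hA x) (sum_bernsteinWeight_mul_exp hab hA h01 x) h2
  have hfx : f x = (Real.exp (lam0 * (x - a)) : ℂ) * g x := by
    rw [hg, ← mul_assoc, ← Complex.ofReal_mul, ← Real.exp_add]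
    simp
  rw [dist_comm, dist_eq_norm, bernsteinOp_eq hab hA, hfx, ← mul_sub, norm_mul,
    Complex.norm_real, Real.norm_of_nonneg (Real.exp_pos _).le]
  have hexp : Real.exp (lam0 * (x - a)) ≤ C :=
    Real.exp_le_exp.2 (mul_le_mul (le_abs_self _) (by linarith [hx.2]) (by linarith [hx.1])
      (abs_nonneg _))
  calc _ ≤ C * (ε / 2 / C) := mul_le_mul hexp h3 (norm_nonneg _) hC.le
    _ = ε / 2 := by field_simp
    _ < ε := by linarith
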